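/- Let $\mathcal Y=\{(1,0),(0,1),(-1,0),(0,-1),(-1,-1)\}$, let $\lambda(y)>0$ for $y\in\mathcal Y$ be constants, and put $c_1=\lambda(-1,0)$, $c_2=\lambda(0,-1)$, $c_3=\lambda(-1,-1)$. Let $\xi(t)$, $t\ge 0$, be the continuous-time Markov jump process on $\mathbb Z_+^2=\{(z_1,z_2)\in\mathbb Z^2: z_1,z_2\ge 0\}$ with $\xi(0)=(0,0)$ whose jumps $z\to z+y$, $y\in\mathcal Y$, have the intensities $$\lambda_z(1,0)=\lambda(1,0),\quad \lambda_z(0,1)=\lambda(0,1),\quad \lambda_z(-1,0)=c_1z_1,\quad \lambda_z(0,-1)=c_2z_2,\quad \lambda_z(-1,-1)=c_3\min\{z_1,z_2\};$$ that is, the process stays in a state $z$ for an exponential time with parameter $h(z)=\sum_{y\in\mathcal Y}\lambda_z(y)$ and then jumps to $z+y$ with probability $\lambda_z(y)/h(z)$. For $T>0$ let $\xi_T(t)=\xi(tT)/T$, $t\in[0,1]$. Let $X$ be the set of càdlàg functions $x=(x_1,x_2):[0,1]\to[0,\infty)^2$ with finitely many jumps and $x(0)=(0,0)$, and let $F\subset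 X$ be the set of continuous $f=(f_1,f_2)\in X$ with $f_1(t)>0$ and $f_2(t)>0$ for all $t\in(0,1]$. For $x\in X$ let $$I(x)=\int_0^1\bigl(c_1x_1(t)+c_2x_2(t)+c_3\min\{x_1(t),x_2(t)\}\bigr)\,dt\ \text{ if } x\in F,\qquad I(x)=\infty\ \text{ if } x\notin F.$$ For $f\in F$, $\varepsilon>0$ and $M>0$ let $$B_{f,\varepsilon,M}=\{x\in X: f_i(t)-\varepsilon\le x_i(t)\le M,\ i=1,2,\ t\in[0,1]\},$$ $$B_{f,M}=\{x\in X: f_i(t)\le x_i(t)\le M,\ i=1,2,\ t\in[0,1]\}.$$ Then for every $f\in F$ and every $M>\sup_{t\in[0,1]}\max\{f_1(t),f_2(t)\}$, the limit $\lim_{T\to\infty}T^{-2}\ln \mathbf P(\xi_T\in B_{f,\varepsilon,M})$ exists for each $\varepsilon>0$, and $$\lim_{\varepsilon\to0}\ \lim_{T\to\infty}\frac1{T^2}\ln\mathbf P\bigl(\xi_T\in B_{f,\varepsilon,M}\bigr)=-\inf_{g\in F\cap B_{f,M}}I(g)=-I(f).$$ -/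

import Mathlib

open MeasureTheory Filter Topology
open scoped NNReal ENNReal

noncomputable section

namespace StripLDP

/-- The set of possible jumps. -/
def jumps : Finset (ℤ × ℤ) := {(1, 0), (0, 1), (-1, 0), (0, -1), (-1, -1)}

/-- The intensity of the jump `y` in the state `z`, where `lam y` is the constant attached to
the jump `y`. It vanishes if `y` is not a jump, or if `z + y` would leave the quadrant. -/
def intensity (lam : ℤ × ℤ → ℝ) (z : ℕ × ℕ) (y : ℤ × ℤ) : ℝ :=
  if y = (1, 0) then lam (1, 0)
  else if y = (0, 1) then lam (0, 1)
  else if y = (-1, 0) then (z.1 : ℝ) * lam (-1, 0)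
  else if y = (0, -1) then (z.2 : ℝ) * lam (0, -1)
  else if y = (-1, -1) then ((min z.1 z.2 : ℕ) : ℝ) * lam (-1, -1)
  else 0

/-- The total intensity `h(z)` of jumps in the state `z`. -/
def totalIntensity (lam : ℤ × ℤ → ℝ) (z : ℕ × ℕ) : ℝ :=
  ∑ y ∈ jumps, intensity lam z y

/-- The probability `p_z(y)` that a jump from the state `z` is the jump `y`. -/
def jumpProb (lam : ℤ × ℤ → ℝ) (z : ℕ × ℕ) (y : ℤ × ℤ) : ℝ :=
  intensity lam z y / totalIntensity lam z

/-- The displacement from the state `z` to the state `w`. -/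
def displacement (z w : ℕ × ℕ) : ℤ × ℤ :=
  ((w.1 : ℤ) - (z.1 : ℤ), (w.2 : ℤ) - (z.2 : ℤ))

/-- `ξ` is (under `P`) the continuous-time Markov jump process on `ℕ × ℕ` started at `(0, 0)`
with the given jump intensities. There are successive states `Z 0, Z 1, …` and holding times
`τ 0, τ 1, …` such that `Z 0 = (0, 0)`, and, given the past, the holding time in the `n`-th state
`z` is exponential with parameter `h(z)`, and the next state is `z + y` with probability `p_z(y)`,
independently of the holding time (this is said through the joint law of
`Z 0, …, Z n, τ 0, …, τ (n - 1)`); and almost surely `ξ` is in the state `Z n` from the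
time `τ 0 + … + τ (n - 1)` of the `n`-th jump until the time of the next one. -/
def IsJumpProcess {Ω : Type*} [MeasurableSpace Ω] (lam : ℤ × ℤ → ℝ) (P : Measure Ω)
    (ξ : ℝ≥0 → Ω → ℕ × ℕ) : Prop :=
  ∃ (Z : ℕ → Ω → ℕ × ℕ) (τ : ℕ → Ω → ℝ),
    (∀ n, Measurable (Z n)) ∧ (∀ n, Measurable (τ n)) ∧
    (∀ (n : ℕ) (z : ℕ → ℕ × ℕ) (t : ℕ → ℝ), (∀ i, 0 ≤ t i) →
      P {ω | (∀ i ≤ n, Z i ω = z i) ∧ ∀ i < n, t i < τ i ω} =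
        if z 0 = (0, 0) then
          ENNReal.ofReal (∏ i ∈ Finset.range n,
            Real.exp (-(totalIntensity lam (z i) * t i)) *
              jumpProb lam (z i) (displacement (z i) (z (i + 1))))
        else 0) ∧
    (∀ᵐ ω ∂P, ∀ (n : ℕ) (t : ℝ≥0),
      ∑ i ∈ Finset.range n, τ i ω ≤ (t : ℝ) →
      (t : ℝ) < ∑ i ∈ Finset.range (n + 1), τ i ω → ξ t ω = Z n ω)

/-- The scaled path `ξ_T(t) = ξ(tT) / T`, `t ∈ [0, 1]`, for `T > 0`. -/
def scaledPath {Ω : Type*} (ξ : ℝ≥0 → Ω → ℕ × ℕ) (T : ℝ) (ω : Ω) : unitInterval → ℝ × ℝ :=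
  fun t => (((ξ (Real.toNNReal ((t : ℝ) * T)) ω).1 : ℝ) / T,
    ((ξ (Real.toNNReal ((t : ℝ) * T)) ω).2 : ℝ) / T)

/-- The space `X` of càdlàg functions from `[0, 1]` to the non-negative quadrant that have finitely
many jumps and start at `(0, 0)`. -/
def pathSpace : Set (unitInterval → ℝ × ℝ) :=
  {x | (∀ t, 0 ≤ (x t).1 ∧ 0 ≤ (x t).2) ∧
    (∀ t, ContinuousWithinAt x (Set.Ici t) t) ∧
    (∀ t, ∃ l, Tendsto x (𝓝[<] t) (𝓝 l)) ∧
    {t | ¬ ContinuousAt x t}.Finite ∧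
    x 0 = (0, 0)}

/-- The set `F` of continuous functions in `X` with positive coordinates at all `t > 0`. -/
def excursions : Set (unitInterval → ℝ × ℝ) :=
  {f | f ∈ pathSpace ∧ Continuous f ∧ f 0 = (0, 0) ∧ ∀ t, 0 < t → 0 < (f t).1 ∧ 0 < (f t).2}

open Classical in
/-- The rate function `I`, with values in `ℝ ∪ {∞}`; it is infinite outside `F`. -/
def rate (lam : ℤ × ℤ → ℝ) (x : unitInterval → ℝ × ℝ) : EReal :=
  if x ∈ excursions then
    ((∫ t : unitInterval, (lam (-1, 0) * (x t).1 + lam (0, -1) * (x t).2 +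
      lam (-1, -1) * min (x t).1 (x t).2) : ℝ) : EReal)
  else ⊤

/-- The strip `B_{f,ε,M}`. -/
def stripEps (f : unitInterval → ℝ × ℝ) (ε M : ℝ) : Set (unitInterval → ℝ × ℝ) :=
  {x | x ∈ pathSpace ∧ ∀ t, ((f t).1 - ε ≤ (x t).1 ∧ (x t).1 ≤ M) ∧
    ((f t).2 - ε ≤ (x t).2 ∧ (x t).2 ≤ M)}

/-- The strip `B_{f,M}`. -/
def strip (f : unitInterval → ℝ × ℝ) (M : ℝ) : Set (unitInterval → ℝ × ℝ) :=
  {x | x ∈ pathSpace ∧ ∀ t, ((f t).1 ≤ (x t).1 ∧ (x t).1 ≤ M) ∧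
    ((f t).2 ≤ (x t).2 ∧ (x t).2 ≤ M)}

/-- `T⁻² ln P(ξ_T ∈ B)`, in the extended reals, so that `ln 0 = -∞`. -/
def logProb {Ω : Type*} [MeasurableSpace Ω] (P : Measure Ω) (ξ : ℝ≥0 → Ω → ℕ × ℕ)
    (B : Set (unitInterval → ℝ × ℝ)) (T : ℝ) : EReal :=
  ((1 / T ^ 2 : ℝ) : EReal) * ENNReal.log (P {ω | scaledPath ξ T ω ∈ B})

end StripLDP

end

namespace StripLDP

open ProbabilityTheory

/-! At scale `T` the downward intensities are of order `T` while the upward ones are bounded.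
Staying near a path `T x(t/T)` for a time of order `T` therefore amounts to making few jumps, and
the price is the exponential of minus the integrated total intensity, which is `T² ∫ cost(x)` to
leading order. Since `cost` is increasing in both coordinates, the cheapest path in the strip
follows its lower edge `max (f - ε) 0`. Hence for each fixed `ε` the limit is `-truncRate lam f ε`.
As `ε → 0` this tends to `-I(f)`, and the same monotonicity shows that `f` minimises the rate over
`B_{f,M}`.

Upper bound (`measure_le_exp`, `measure_stripEps_le`): in the strip, the total intensity integrated
over `[0, T]` is at least `T² * truncRate`. An exponential Chebyshev inequality along the jump
chain, with the weight `√T ^ (z₁ + z₂)` and a correction `exp (-aτ)`, `a` of order `√T`, contracts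
by `1/2` at each jump. The sum over the number of jumps then converges, and the correction
contributes only `O(T^{3/2})` to the exponent.

Lower bound (`reach_levels`, `HasJumpLaw.le_measure_stripEps`): divide `[0, T]` into `K` pieces,
hold the process on each piece at a level slightly above the lower edge, and between pieces move
along a lattice path, each jump falling in a time window of length `1/T²`. The `O(T)` jumps cost a
factor `exp (-O(T log T))`, and the holding times give a Riemann sum of `truncCost`.

Both bounds rest on the Markov property (`markov`, `lintegral_markov`), derived from the prescribed
joint law by uniqueness of measures on a π-system. The strip event is only ever compared with other
events up to null sets, so its measurability plays no role. -/

/-! ### Exponential distribution. -/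

lemma expMeasure_Ioi {r : ℝ} (hr : 0 < r) (t : ℝ) :
    expMeasure r (Set.Ioi t) = ENNReal.ofReal (Real.exp (-(r * max t 0))) := by
  have := isProbabilityMeasure_expMeasure hr
  have h1 : expMeasure r (Set.Iic t) =
      ENNReal.ofReal (1 - Real.exp (-(r * max t 0))) := by
    rw [← ofReal_cdf, cdf_expMeasure_eq hr]
    split_ifs with h
    · rw [max_eq_left h]
    · rw [max_eq_right (not_le.1 h).le]; simp
  rw [← Set.compl_Iic, prob_compl_eq_one_sub measurableSet_Iic, h1, ← ENNReal.ofReal_one,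
    ← ENNReal.ofReal_sub]
  · congr 1; ring
  · have : Real.exp (-(r * max t 0)) ≤ 1 :=
      Real.exp_le_one_iff.2 (by have := mul_nonneg hr.le (le_max_right t 0); linarith)
    linarith

lemma expMeasure_Ioc {r : ℝ} (hr : 0 < r) {L η : ℝ} (hL : 0 ≤ L) (hη : 0 ≤ η) :
    expMeasure r (Set.Ioc L (L + η)) =
      ENNReal.ofReal (Real.exp (-(r * L)) * (1 - Real.exp (-(r * η)))) := by
  have := isProbabilityMeasure_expMeasure hr
  have : Set.Ioc L (L + η) = Set.Ioi L \ Set.Ioi (L + η) := by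
    ext x; simp
  rw [this, measure_sdiff (Set.Ioi_subset_Ioi (by linarith)) measurableSet_Ioi.nullMeasurableSet
    (measure_ne_top _ _), expMeasure_Ioi hr, expMeasure_Ioi hr, max_eq_left hL,
    max_eq_left (by linarith), ← ENNReal.ofReal_sub _ (Real.exp_pos _).le]
  congr 1
  rw [mul_sub, ← Real.exp_add]
  ring_nf

/-- The moment generating function of the exponential distribution. -/
lemma lintegral_exp_expMeasure {r b : ℝ} (hr : 0 < r) (hb : b < r) :
    ∫⁻ t, ENNReal.ofReal (Real.exp (b * t)) ∂(expMeasure r) = ENNReal.ofReal (r / (r - b)) := by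
  have hrb : 0 < r - b := by linarith
  have h0 : expMeasure r = volume.withDensity (exponentialPDF r) := rfl
  have hm : Measurable (exponentialPDF r) := by unfold exponentialPDF; fun_prop
  have hm' : Measurable (exponentialPDF (r - b)) := by unfold exponentialPDF; fun_prop
  rw [h0, lintegral_withDensity_eq_lintegral_mul _ hm (by fun_prop)]
  have : ∀ t, (exponentialPDF r * fun t => ENNReal.ofReal (Real.exp (b * t))) t =
      ENNReal.ofReal (r / (r - b)) * exponentialPDF (r - b) t := by
    intro t
    simp only [Pi.mul_apply, exponentialPDF_eq]
    rw [← ENNReal.ofReal_mul (by split_ifs <;> positivity), ← ENNReal.ofReal_mul (by positivity)]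
    congr 1
    split_ifs
    · rw [mul_assoc, ← Real.exp_add, ← mul_assoc, div_mul_cancel₀ _ hrb.ne']
      ring_nf
    · simp
  rw [lintegral_congr this, lintegral_const_mul _ hm', lintegral_exponentialPDF_eq_one hrb, mul_one]

/-! ### Intensities and jump probabilities. -/

lemma totalIntensity_eq (lam : ℤ × ℤ → ℝ) (z : ℕ × ℕ) :
    totalIntensity lam z = lam (1, 0) + lam (0, 1) + (z.1 * lam (-1, 0) + z.2 * lam (0, -1) +
      ((min z.1 z.2 : ℕ) : ℝ) * lam (-1, -1)) := by
  simp [totalIntensity, jumps, intensity]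
  ring

lemma lam_pos {lam : ℤ × ℤ → ℝ} (hlam : ∀ y ∈ jumps, 0 < lam y) :
    0 < lam (1, 0) ∧ 0 < lam (0, 1) ∧ 0 < lam (-1, 0) ∧ 0 < lam (0, -1) ∧
    0 < lam (-1, -1) := by
  refine ⟨hlam _ ?_, hlam _ ?_, hlam _ ?_, hlam _ ?_, hlam _ ?_⟩ <;> simp [jumps]

lemma totalIntensity_pos {lam : ℤ × ℤ → ℝ} (hlam : ∀ y ∈ jumps, 0 < lam y)
    (z : ℕ × ℕ) : 0 < totalIntensity lam z := by
  obtain ⟨h1, h2, h3, h4, h5⟩ := lam_pos hlam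
  rw [totalIntensity_eq]
  positivity

lemma intensity_nonneg {lam : ℤ × ℤ → ℝ} (hlam : ∀ y ∈ jumps, 0 < lam y)
    (z : ℕ × ℕ) (y : ℤ × ℤ) : 0 ≤ intensity lam z y := by
  obtain ⟨h1, h2, h3, h4, h5⟩ := lam_pos hlam
  unfold intensity
  split_ifs <;> positivity

lemma jumpProb_nonneg {lam : ℤ × ℤ → ℝ} (hlam : ∀ y ∈ jumps, 0 < lam y)
    (z : ℕ × ℕ) (y : ℤ × ℤ) : 0 ≤ jumpProb lam z y :=
  div_nonneg (intensity_nonneg hlam z y) (totalIntensity_pos hlam z).le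

/-- Truncated subtraction is harmless here: when a coordinate of `z` is zero, the downward terms in
that direction have weight zero, even if their target states coincide with others. -/
lemma ofReal_intensity_eq (lam : ℤ × ℤ → ℝ) (z w : ℕ × ℕ) :
    ENNReal.ofReal (intensity lam z (displacement z w)) =
      (if w = (z.1 + 1, z.2) then ENNReal.ofReal (lam (1, 0)) else 0) +
      (if w = (z.1, z.2 + 1) then ENNReal.ofReal (lam (0, 1)) else 0) +
      (if w = (z.1 - 1, z.2) then ENNReal.ofReal (z.1 * lam (-1, 0)) else 0) +
      (if w = (z.1, z.2 - 1) then ENNReal.ofReal (z.2 * lam (0, -1)) else 0) +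
      (if w = (z.1 - 1, z.2 - 1) then
        ENNReal.ofReal (((min z.1 z.2 : ℕ) : ℝ) * lam (-1, -1)) else 0) := by
  obtain ⟨a, b⟩ := z
  obtain ⟨c, d⟩ := w
  simp only [intensity, displacement, Prod.mk.injEq]
  rcases Nat.eq_zero_or_pos a with ha | ha <;> rcases Nat.eq_zero_or_pos b with hb | hb
  · subst ha hb
    split_ifs <;> first | (exfalso; omega) | simp
  · subst ha
    split_ifs <;> first | (exfalso; omega) | simp
  · subst hb
    split_ifs <;> first | (exfalso; omega) | simp
  · split_ifs <;> first | (exfalso; omega) | simp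

/-- A sum weighted by the intensities of the jumps from `z` has only five terms. -/
lemma tsum_intensity_mul (lam : ℤ × ℤ → ℝ)
    (z : ℕ × ℕ) (v : ℕ × ℕ → ℝ≥0∞) :
    ∑' w, ENNReal.ofReal (intensity lam z (displacement z w)) * v w =
      ENNReal.ofReal (lam (1, 0)) * v (z.1 + 1, z.2) +
      ENNReal.ofReal (lam (0, 1)) * v (z.1, z.2 + 1) +
      ENNReal.ofReal (z.1 * lam (-1, 0)) * v (z.1 - 1, z.2) +
      ENNReal.ofReal (z.2 * lam (0, -1)) * v (z.1, z.2 - 1) +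
      ENNReal.ofReal (((min z.1 z.2 : ℕ) : ℝ) * lam (-1, -1)) * v (z.1 - 1, z.2 - 1) := by
  have key : ∀ (w₀ : ℕ × ℕ) (c : ℝ≥0∞), ∑' w, (if w = w₀ then c else 0) * v w = c * v w₀ := by
    intro w₀ c
    rw [tsum_eq_single w₀ (by intro w hw; simp [hw])]
    simp
  simp_rw [ofReal_intensity_eq lam, add_mul]
  rw [ENNReal.tsum_add, ENNReal.tsum_add, ENNReal.tsum_add, ENNReal.tsum_add]
  simp_rw [key]

lemma tsum_jumpProb_mul {lam : ℤ × ℤ → ℝ} (hlam : ∀ y ∈ jumps, 0 < lam y)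
    (z : ℕ × ℕ) (v : ℕ × ℕ → ℝ≥0∞) :
    ∑' w, ENNReal.ofReal (jumpProb lam z (displacement z w)) * v w =
      (∑' w, ENNReal.ofReal (intensity lam z (displacement z w)) * v w) /
        ENNReal.ofReal (totalIntensity lam z) := by
  rw [div_eq_mul_inv, ← ENNReal.tsum_mul_right]
  refine tsum_congr fun w => ?_
  rw [jumpProb, ENNReal.ofReal_div_of_pos (totalIntensity_pos hlam z), div_eq_mul_inv]
  ring

lemma tsum_jumpProb {lam : ℤ × ℤ → ℝ} (hlam : ∀ y ∈ jumps, 0 < lam y)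
    (z : ℕ × ℕ) :
    ∑' w, ENNReal.ofReal (jumpProb lam z (displacement z w)) = 1 := by
  have h := tsum_jumpProb_mul hlam z (fun _ => 1)
  simp only [mul_one] at h
  have h2 := tsum_intensity_mul lam z (fun _ => 1)
  simp only [mul_one] at h2
  obtain ⟨h1, h2', h3, h4, h5⟩ := lam_pos hlam
  rw [h, h2, ← ENNReal.ofReal_add, ← ENNReal.ofReal_add, ← ENNReal.ofReal_add, ← ENNReal.ofReal_add,
    ← ENNReal.ofReal_div_of_pos (totalIntensity_pos hlam z)] <;> try positivity
  rw [← ENNReal.ofReal_one, ← div_self (totalIntensity_pos hlam z).ne']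
  congr 2
  rw [totalIntensity_eq]
  ring

/-! ### The σ-algebra of the past. -/

/-- The joint law of the successive states `Z` and holding times `τ` of the jump process. -/
structure HasJumpLaw {Ω : Type*} [MeasurableSpace Ω] (lam : ℤ × ℤ → ℝ) (P : Measure Ω)
    (Z : ℕ → Ω → ℕ × ℕ) (τ : ℕ → Ω → ℝ) : Prop where
  measurable_state : ∀ n, Measurable (Z n)
  measurable_time : ∀ n, Measurable (τ n)
  law : ∀ (n : ℕ) (z : ℕ → ℕ × ℕ) (t : ℕ → ℝ), (∀ i, 0 ≤ t i) →
      P {ω | (∀ i ≤ n, Z i ω = z i) ∧ ∀ i < n, t i < τ i ω} =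
        if z 0 = (0, 0) then
          ENNReal.ofReal (∏ i ∈ Finset.range n,
            Real.exp (-(totalIntensity lam (z i) * t i)) *
              jumpProb lam (z i) (displacement (z i) (z (i + 1))))
        else 0

/-- The event that the first states are given and the first holding times exceed given times. -/
def cylinder {Ω : Type*} (Z : ℕ → Ω → ℕ × ℕ) (τ : ℕ → Ω → ℝ) (n : ℕ) (z : ℕ → ℕ × ℕ)
    (t : ℕ → ℝ) : Set Ω :=
  {ω | (∀ i ≤ n, Z i ω = z i) ∧ ∀ i < n, t i < τ i ω}

/-- The events that can be observed up to the `n`-th jump. -/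
abbrev past {Ω : Type*} (Z : ℕ → Ω → ℕ × ℕ) (τ : ℕ → Ω → ℝ) (n : ℕ) : MeasurableSpace Ω :=
  MeasurableSpace.generateFrom (insert ∅ {E | ∃ z t, E = cylinder Z τ n z t})

/-- A finite sequence of states, continued by `(0, 0)`. -/
def extendState {n : ℕ} (v : Fin (n + 1) → ℕ × ℕ) (i : ℕ) : ℕ × ℕ :=
  if h : i < n + 1 then v ⟨i, h⟩ else (0, 0)

section Past

variable {Ω : Type*} {Z : ℕ → Ω → ℕ × ℕ} {τ : ℕ → Ω → ℝ}

lemma extendState_self {n i : ℕ} (hi : i ≤ n) (ω : Ω) :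
    extendState (fun j : Fin (n + 1) => Z j ω) i = Z i ω := by
  simp [extendState, Nat.lt_succ_of_le hi]

lemma exists_nat_lt_times (n : ℕ) (ω : Ω) : ∃ k : ℕ, ∀ i < n, -(k : ℝ) < τ i ω := by
  induction n with
  | zero => exact ⟨0, by simp⟩
  | succ n ih =>
    obtain ⟨k, hk⟩ := ih
    obtain ⟨m, hm⟩ := exists_nat_gt (-τ n ω)
    refine ⟨max k m, fun i hi => ?_⟩
    have h1 : (k : ℝ) ≤ ((max k m : ℕ) : ℝ) := by exact_mod_cast le_max_left _ _
    have h2 : (m : ℝ) ≤ ((max k m : ℕ) : ℝ) := by exact_mod_cast le_max_right _ _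
    rcases Nat.lt_succ_iff_lt_or_eq.1 hi with h | h
    · have := hk i h; linarith
    · subst h; linarith

/-- Two cylinders with a common point prescribe the same states up to index `n`, so they meet in the
cylinder with the larger thresholds. -/
lemma isPiSystem_cylinder (n : ℕ) :
    IsPiSystem (insert ∅ {E | ∃ z t, E = cylinder Z τ n z t}) := by
  rintro A (rfl | ⟨z, t, rfl⟩) B (rfl | ⟨z', t', rfl⟩) hne
  · left; simp
  · left; simp
  · left; simp
  · right
    refine ⟨z, fun i => max (t i) (t' i), ?_⟩
    obtain ⟨ω₀, h0, h0'⟩ := hne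
    ext ω
    simp only [cylinder, Set.mem_inter_iff, Set.mem_ofPred_eq, max_lt_iff]
    constructor
    · rintro ⟨h1, h2⟩
      exact ⟨h1.1, fun i hi => ⟨h1.2 i hi, h2.2 i hi⟩⟩
    · rintro ⟨h1, h2⟩
      refine ⟨⟨h1, fun i hi => (h2 i hi).1⟩, fun i hi => ?_, fun i hi => (h2 i hi).2⟩
      rw [h1 i hi, ← h0.1 i hi, h0'.1 i hi]

lemma measurableSet_past_cylinder (n : ℕ) (z : ℕ → ℕ × ℕ) (t : ℕ → ℝ) :
    MeasurableSet[past Z τ n] (cylinder Z τ n z t) :=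
  MeasurableSpace.measurableSet_generateFrom (Or.inr ⟨z, t, rfl⟩)

/-- A cylinder sees only `n + 1` states, so finite sequences continued by `extendState` suffice, and
there are countably many of them. The thresholds `-k` exhaust all values of the times. The preimage
is thus a countable union of cylinders. -/
lemma measurable_past_state {n i : ℕ} (hi : i ≤ n) : Measurable[past Z τ n] (Z i) := by
  refine @measurable_to_countable' _ _ _ _ (past Z τ n) _ fun w => ?_
  have : Z i ⁻¹' {w} = ⋃ (v : Fin (n + 1) → ℕ × ℕ) (k : ℕ),
      if extendState v i = w then cylinder Z τ n (extendState v) (fun _ => -(k : ℝ)) else ∅ := by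
    ext ω
    simp only [Set.mem_preimage, Set.mem_singleton_iff, Set.mem_iUnion]
    constructor
    · intro h
      obtain ⟨k, hk⟩ := exists_nat_lt_times (τ := τ) n ω
      refine ⟨fun j => Z j ω, k, ?_⟩
      rw [if_pos (by rw [extendState_self hi, h])]
      exact ⟨fun j hj => (extendState_self hj ω).symm, hk⟩
    · rintro ⟨v, k, h⟩
      split_ifs at h with hv
      · rw [h.1 i hi, hv]
      · exact h.elim
  rw [this]
  refine @MeasurableSet.iUnion _ _ (past Z τ n) _ _ fun v =>
    @MeasurableSet.iUnion _ _ (past Z τ n) _ _ fun k => ?_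
  split_ifs
  · exact measurableSet_past_cylinder _ _ _
  · exact @MeasurableSet.empty _ (past Z τ n)

lemma measurable_past_time {n i : ℕ} (hi : i < n) : Measurable[past Z τ n] (τ i) := by
  refine measurable_of_Ioi (mδ := past Z τ n) fun s => ?_
  have : τ i ⁻¹' Set.Ioi s = ⋃ (v : Fin (n + 1) → ℕ × ℕ) (k : ℕ),
      cylinder Z τ n (extendState v) (Function.update (fun _ => -(k : ℝ)) i s) := by
    ext ω
    simp only [Set.mem_preimage, Set.mem_Ioi, Set.mem_iUnion]
    constructor
    · intro h
      obtain ⟨k, hk⟩ := exists_nat_lt_times (τ := τ) n ω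
      refine ⟨fun j => Z j ω, k, fun j hj => (extendState_self hj ω).symm, fun j hj => ?_⟩
      rcases eq_or_ne j i with rfl | hji
      · simpa using h
      · simpa [hji] using hk j hj
    · rintro ⟨v, k, h⟩
      simpa using h.2 i hi
  rw [this]
  exact @MeasurableSet.iUnion _ _ (past Z τ n) _ _ fun v =>
    @MeasurableSet.iUnion _ _ (past Z τ n) _ _ fun k => measurableSet_past_cylinder _ _ _

lemma past_le_of_measurable [m : MeasurableSpace Ω] (hZ : ∀ n, Measurable (Z n)) (hτ : ∀ n, Measurable (τ n))
    (n : ℕ) : past Z τ n ≤ m := by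
  refine MeasurableSpace.generateFrom_le ?_
  rintro E (rfl | ⟨z, t, rfl⟩)
  · exact MeasurableSet.empty
  · have : cylinder Z τ n z t = (⋂ i ≤ n, Z i ⁻¹' {z i}) ∩ ⋂ i < n, τ i ⁻¹' Set.Ioi (t i) := by
      ext ω; simp [cylinder]
    rw [this]
    refine MeasurableSet.inter ?_ ?_
    · exact MeasurableSet.iInter fun i => MeasurableSet.iInter fun _ => hZ i (measurableSet_singleton _)
    · exact MeasurableSet.iInter fun i => MeasurableSet.iInter fun _ => hτ i measurableSet_Ioi

lemma past_mono {m n : ℕ} (hmn : m ≤ n) : past Z τ m ≤ past Z τ n := by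
  refine MeasurableSpace.generateFrom_le ?_
  rintro E (rfl | ⟨z, t, rfl⟩)
  · exact @MeasurableSet.empty _ (past Z τ n)
  · have : cylinder Z τ m z t = (⋂ i ≤ m, Z i ⁻¹' {z i}) ∩ ⋂ i < m, τ i ⁻¹' Set.Ioi (t i) := by
      ext ω; simp [cylinder]
    rw [this]
    refine @MeasurableSet.inter _ (past Z τ n) _ _ ?_ ?_
    · exact @MeasurableSet.iInter _ _ (past Z τ n) _ _ fun i =>
        @MeasurableSet.iInter _ _ (past Z τ n) _ _ fun hi =>
          measurable_past_state (hi.trans hmn) (measurableSet_singleton _)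
    · exact @MeasurableSet.iInter _ _ (past Z τ n) _ _ fun i =>
        @MeasurableSet.iInter _ _ (past Z τ n) _ _ fun hi =>
          measurable_past_time (lt_of_lt_of_le hi hmn) measurableSet_Ioi

end Past

/-! ### The Markov property. -/

section Markov

variable {Ω : Type*} [MeasurableSpace Ω] {lam : ℤ × ℤ → ℝ} {P : Measure Ω}
  {Z : ℕ → Ω → ℕ × ℕ} {τ : ℕ → Ω → ℝ}

lemma HasJumpLaw.past_le (h : HasJumpLaw lam P Z τ) (n : ℕ) :
    past Z τ n ≤ (inferInstance : MeasurableSpace Ω) :=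
  past_le_of_measurable h.measurable_state h.measurable_time n

lemma HasJumpLaw.measurableSet_cylinder (h : HasJumpLaw lam P Z τ) (n : ℕ) (z : ℕ → ℕ × ℕ)
    (t : ℕ → ℝ) : MeasurableSet (cylinder Z τ n z t) :=
  past_le_of_measurable h.measurable_state h.measurable_time n _ (measurableSet_past_cylinder n z t)

lemma HasJumpLaw.measure_eq_tsum_state (h : HasJumpLaw lam P Z τ) (n : ℕ) {s : Set Ω}
    (hs : MeasurableSet s) : P s = ∑' w, P (s ∩ Z n ⁻¹' {w}) := by
  have h1 : s = ⋃ w, s ∩ Z n ⁻¹' {w} := by ext ω; simp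
  conv_lhs => rw [h1]
  refine measure_iUnion ?_ fun w => hs.inter (h.measurable_state n (measurableSet_singleton _))
  intro w w' hne
  refine Set.disjoint_left.2 fun ω h1 h2 => hne ?_
  rw [← h1.2, ← h2.2]

lemma HasJumpLaw.measure_eq_tsum_states (h : HasJumpLaw lam P Z τ) (n : ℕ) {s : Set Ω}
    (hs : MeasurableSet s) :
    P s = ∑' v : Fin (n + 1) → ℕ × ℕ, P (s ∩ {ω | ∀ i ≤ n, Z i ω = extendState v i}) := by
  have hm : ∀ v : Fin (n + 1) → ℕ × ℕ, MeasurableSet {ω | ∀ i ≤ n, Z i ω = extendState v i} := by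
    intro v
    have : {ω | ∀ i ≤ n, Z i ω = extendState v i} = ⋂ i ≤ n, Z i ⁻¹' {extendState v i} := by
      ext; simp
    rw [this]
    exact MeasurableSet.iInter fun i => MeasurableSet.iInter fun _ =>
      h.measurable_state i (measurableSet_singleton _)
  have h1 : s = ⋃ v : Fin (n + 1) → ℕ × ℕ, s ∩ {ω | ∀ i ≤ n, Z i ω = extendState v i} := by
    ext ω
    simp only [Set.mem_iUnion, Set.mem_inter_iff, exists_and_left]
    refine ⟨fun hω => ⟨hω, fun j => Z j ω, fun i hi => (extendState_self hi ω).symm⟩, fun hω => hω.1⟩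
  conv_lhs => rw [h1]
  refine measure_iUnion ?_ fun v => hs.inter (hm v)
  intro v v' hne
  refine Set.disjoint_left.2 fun ω h1 h2 => hne ?_
  funext i
  have h3 := h1.2 i (Nat.lt_succ_iff.1 i.2)
  have h4 := h2.2 i (Nat.lt_succ_iff.1 i.2)
  rw [h3] at h4
  simpa [extendState, Nat.lt_succ_iff.1 i.2] using h4

lemma prod_update (n : ℕ) (z : ℕ → ℕ × ℕ) (w : ℕ × ℕ) (t : ℕ → ℝ) (s : ℝ) :
    ∏ i ∈ Finset.range (n + 1), Real.exp (-(totalIntensity lam (Function.update z (n + 1) w i) *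
        Function.update t n s i)) * jumpProb lam (Function.update z (n + 1) w i)
          (displacement (Function.update z (n + 1) w i) (Function.update z (n + 1) w (i + 1))) =
      (∏ i ∈ Finset.range n, Real.exp (-(totalIntensity lam (z i) * t i)) *
        jumpProb lam (z i) (displacement (z i) (z (i + 1)))) *
        (Real.exp (-(totalIntensity lam (z n) * s)) *
          jumpProb lam (z n) (displacement (z n) w)) := by
  rw [Finset.prod_range_succ]
  congr 1
  · refine Finset.prod_congr rfl fun i hi => ?_
    have := Finset.mem_range.1 hi
    simp [Function.update_of_ne (show i ≠ n + 1 by omega), Function.update_of_ne (show i ≠ n by omega),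
      Function.update_of_ne (show i + 1 ≠ n + 1 by omega)]
  · simp

/-- The one-step extension of the joint law. -/
lemma HasJumpLaw.law_succ (h : HasJumpLaw lam P Z τ) (hlam : ∀ y ∈ jumps, 0 < lam y)
    (n : ℕ) (z : ℕ → ℕ × ℕ) (w : ℕ × ℕ) (t : ℕ → ℝ) (ht : ∀ i, 0 ≤ t i) {s : ℝ} (hs : 0 ≤ s) :
    P (cylinder Z τ n z t ∩ {ω | s < τ n ω ∧ Z (n + 1) ω = w}) =
      P (cylinder Z τ n z t) * ENNReal.ofReal (jumpProb lam (z n) (displacement (z n) w)) *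
        ENNReal.ofReal (Real.exp (-(totalIntensity lam (z n) * s))) := by
  have h1 : cylinder Z τ n z t ∩ {ω | s < τ n ω ∧ Z (n + 1) ω = w} =
      cylinder Z τ (n + 1) (Function.update z (n + 1) w) (Function.update t n s) := by
    ext ω
    simp only [cylinder, Set.mem_inter_iff, Set.mem_ofPred_eq]
    constructor
    · rintro ⟨⟨h1, h2⟩, h3, h4⟩
      refine ⟨fun i hi => ?_, fun i hi => ?_⟩
      · rcases eq_or_ne i (n + 1) with rfl | hne
        · simpa using h4
        · simpa [hne] using h1 i (by omega)
      · rcases eq_or_ne i n with rfl | hne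
        · simpa using h3
        · simpa [hne] using h2 i (by omega)
    · rintro ⟨h1, h2⟩
      refine ⟨⟨fun i hi => ?_, fun i hi => ?_⟩, ?_, ?_⟩
      · simpa [show i ≠ n + 1 by omega] using h1 i (by omega)
      · simpa [show i ≠ n by omega] using h2 i (by omega)
      · simpa using h2 n (by omega)
      · simpa using h1 (n + 1) le_rfl
  rw [h1, cylinder, cylinder, h.law, h.law _ _ _ ht]
  · rw [Function.update_of_ne (by omega)]
    split_ifs
    · rw [prod_update, ENNReal.ofReal_mul, ENNReal.ofReal_mul (Real.exp_pos _).le]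
      · ring
      · exact Finset.prod_nonneg fun i _ => mul_nonneg (Real.exp_pos _).le (jumpProb_nonneg hlam _ _)
    · simp
  · intro i
    rcases eq_or_ne i n with rfl | hne
    · simpa using hs
    · simpa [hne] using ht i

variable [IsProbabilityMeasure P]

/-- Positivity of the times is not postulated. It follows from the law at threshold `0`: requiring
`0 < τ n` in addition loses no mass, because the jump probabilities sum to one. -/
lemma HasJumpLaw.measure_times_pos (h : HasJumpLaw lam P Z τ) (hlam : ∀ y ∈ jumps, 0 < lam y)
    (n : ℕ) : P {ω | ∀ i < n, 0 < τ i ω} = 1 := by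
  have hm : ∀ n, MeasurableSet {ω | ∀ i < n, 0 < τ i ω} := by
    intro n
    have : {ω | ∀ i < n, 0 < τ i ω} = ⋂ i < n, τ i ⁻¹' Set.Ioi 0 := by ext; simp
    rw [this]
    exact MeasurableSet.iInter fun i => MeasurableSet.iInter fun _ =>
      h.measurable_time i measurableSet_Ioi
  induction n with
  | zero => simp
  | succ n ih =>
    rw [← ih, h.measure_eq_tsum_states n (hm (n + 1)), h.measure_eq_tsum_states n (hm n)]
    refine tsum_congr fun v => ?_
    have e1 : {ω | ∀ i < n, 0 < τ i ω} ∩ {ω | ∀ i ≤ n, Z i ω = extendState v i} =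
        cylinder Z τ n (extendState v) 0 := by
      ext ω; simp [cylinder, and_comm]
    have e2 : {ω | ∀ i < n + 1, 0 < τ i ω} ∩ {ω | ∀ i ≤ n, Z i ω = extendState v i} =
        cylinder Z τ n (extendState v) 0 ∩ τ n ⁻¹' Set.Ioi 0 := by
      ext ω
      simp only [cylinder, Set.mem_inter_iff, Set.mem_ofPred_eq, Set.mem_preimage, Set.mem_Ioi,
        Nat.forall_lt_succ_right, Pi.zero_apply]
      tauto
    rw [e1, e2, h.measure_eq_tsum_state (n + 1)
      ((h.measurableSet_cylinder _ _ _).inter (h.measurable_time n measurableSet_Ioi))]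
    have : ∀ w, P (cylinder Z τ n (extendState v) 0 ∩ τ n ⁻¹' Set.Ioi 0 ∩ Z (n + 1) ⁻¹' {w}) =
        P (cylinder Z τ n (extendState v) 0) * ENNReal.ofReal (jumpProb lam (extendState v n)
          (displacement (extendState v n) w)) := by
      intro w
      have := h.law_succ hlam n (extendState v) w 0 (fun _ => le_rfl) le_rfl
      simp only [mul_zero, neg_zero, Real.exp_zero, ENNReal.ofReal_one, mul_one] at this
      rw [← this, Set.inter_assoc]
      rfl
    simp_rw [this]
    rw [ENNReal.tsum_mul_left, tsum_jumpProb hlam, mul_one]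

lemma HasJumpLaw.ae_times_pos (h : HasJumpLaw lam P Z τ) (hlam : ∀ y ∈ jumps, 0 < lam y) :
    ∀ᵐ ω ∂P, ∀ i, 0 < τ i ω := by
  rw [ae_all_iff]
  intro i
  have hm : MeasurableSet {ω | 0 < τ i ω} := h.measurable_time i measurableSet_Ioi
  refine (mem_ae_iff_prob_eq_one hm).2 (le_antisymm prob_le_one ?_)
  rw [← h.measure_times_pos hlam (i + 1)]
  exact measure_mono fun ω hω => hω i (by omega)

/-- The Markov property on cylinders. -/
lemma HasJumpLaw.markov_cylinder (h : HasJumpLaw lam P Z τ) (hlam : ∀ y ∈ jumps, 0 < lam y)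
    (n : ℕ) (z : ℕ → ℕ × ℕ) (w : ℕ × ℕ) (t : ℕ → ℝ) (s : ℝ) :
    P (cylinder Z τ n z t ∩ {ω | s < τ n ω ∧ Z (n + 1) ω = w}) =
      P (cylinder Z τ n z t) * ENNReal.ofReal (jumpProb lam (z n) (displacement (z n) w)) *
        expMeasure (totalIntensity lam (z n)) (Set.Ioi s) := by
  -- The law is prescribed for nonnegative thresholds only; as the times are almost surely positive,
  -- negative thresholds may be replaced by `0`.
  have hae : cylinder Z τ n z t =ᵐ[P] cylinder Z τ n z (fun i => max (t i) 0) := by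
    filter_upwards [h.ae_times_pos hlam] with ω hω
    refine propext ⟨fun h => ⟨h.1, fun i hi => max_lt (h.2 i hi) (hω i)⟩, fun h => ⟨h.1, fun i hi =>
      lt_of_le_of_lt (le_max_left _ _) (h.2 i hi)⟩⟩
  have hae2 : {ω | s < τ n ω ∧ Z (n + 1) ω = w} =ᵐ[P] {ω | max s 0 < τ n ω ∧ Z (n + 1) ω = w} := by
    filter_upwards [h.ae_times_pos hlam] with ω hω
    refine propext ⟨fun h => ⟨max_lt h.1 (hω n), h.2⟩, fun h =>
      ⟨lt_of_le_of_lt (le_max_left _ _) h.1, h.2⟩⟩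
  rw [measure_congr (hae.inter hae2), measure_congr hae, h.law_succ hlam _ _ _ _
    (fun i => le_max_right _ _) (le_max_right _ _), expMeasure_Ioi (totalIntensity_pos hlam _)]

end Markov

lemma measurable_past_prod {Ω : Type*} {Z : ℕ → Ω → ℕ × ℕ} {τ : ℕ → Ω → ℝ}
    {φ : ℕ × ℕ → ℝ → ℝ≥0∞} (hφ : ∀ z, Measurable (φ z)) (n : ℕ) :
    Measurable[past Z τ n] fun ω => ∏ i ∈ Finset.range n, φ (Z i ω) (τ i ω) := by
  let _ := past Z τ n
  refine Finset.measurable_prod _ fun i hi => ?_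
  have hi' : i < n := Finset.mem_range.1 hi
  have h1 : Measurable fun p : (ℕ × ℕ) × ℝ => φ p.1 p.2 := measurable_from_prod_countable_right hφ
  exact h1.comp ((measurable_past_state hi'.le).prodMk (measurable_past_time hi'))

section MarkovGeneral

variable {Ω : Type*} [MeasurableSpace Ω] {lam : ℤ × ℤ → ℝ} {P : Measure Ω}
  {Z : ℕ → Ω → ℕ × ℕ} {τ : ℕ → Ω → ℝ} [IsProbabilityMeasure P]

/-- Both sides are finite measures in `E` on the past. They agree on the π-system of cylinders, and
countably many cylinders cover the space. -/
lemma HasJumpLaw.markov_Ioi (h : HasJumpLaw lam P Z τ) (hlam : ∀ y ∈ jumps, 0 < lam y)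
    (n : ℕ) (z w : ℕ × ℕ) (s : ℝ) {E : Set Ω} (hE : MeasurableSet[past Z τ n] E) :
    P (E ∩ {ω | Z n ω = z ∧ s < τ n ω ∧ Z (n + 1) ω = w}) =
      P (E ∩ {ω | Z n ω = z}) * (ENNReal.ofReal (jumpProb lam z (displacement z w)) *
        expMeasure (totalIntensity lam z) (Set.Ioi s)) := by
  set c := ENNReal.ofReal (jumpProb lam z (displacement z w)) *
        expMeasure (totalIntensity lam z) (Set.Ioi s) with hc
  have hle := h.past_le n
  have hEm := hle _ hE
  suffices (P.restrict {ω | Z n ω = z ∧ s < τ n ω ∧ Z (n + 1) ω = w}).trim hle =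
      (c • P.restrict {ω | Z n ω = z}).trim hle by
    have h2 := congrArg (fun μ => μ E) this
    simp only [trim_measurableSet_eq hle hE] at h2
    rw [Measure.restrict_apply hEm, Measure.smul_apply, Measure.restrict_apply hEm] at h2
    rw [h2, smul_eq_mul, mul_comm]
  refine @Measure.ext_of_generateFrom_of_cover_subset Ω (past Z τ n) _ _ _
    {E | ∃ (v : Fin (n + 1) → ℕ × ℕ) (k : ℕ), E = cylinder Z τ n (extendState v) fun _ => -(k : ℝ)}
    rfl (isPiSystem_cylinder n) ?_ ?_ ?_ ?_ ?_
  · rintro E ⟨v, k, rfl⟩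
    exact Or.inr ⟨_, _, rfl⟩
  · have : {E | ∃ (v : Fin (n + 1) → ℕ × ℕ) (k : ℕ), E = cylinder Z τ n (extendState v) fun _ => -(k : ℝ)}
      = Set.range fun p : (Fin (n + 1) → ℕ × ℕ) × ℕ =>
        cylinder Z τ n (extendState p.1) fun _ => -(p.2 : ℝ) := by
      ext E
      simp [eq_comm]
    rw [this]
    exact Set.countable_range _
  · refine Set.eq_univ_of_forall fun ω => ?_
    obtain ⟨k, hk⟩ := exists_nat_lt_times (τ := τ) n ω
    exact ⟨_, ⟨fun j => Z j ω, k, rfl⟩, fun j hj => (extendState_self hj ω).symm, hk⟩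
  · rintro E ⟨v, k, rfl⟩
    rw [trim_measurableSet_eq hle (measurableSet_past_cylinder _ _ _)]
    exact measure_ne_top _ _
  · rintro E (rfl | ⟨z', t, rfl⟩)
    · simp
    have hmp := measurableSet_past_cylinder (Z := Z) (τ := τ) n z' t
    rw [trim_measurableSet_eq hle hmp, trim_measurableSet_eq hle hmp, Measure.smul_apply,
      Measure.restrict_apply (hle _ hmp), Measure.restrict_apply (hle _ hmp), smul_eq_mul]
    by_cases hz : z' n = z
    · have e1 : cylinder Z τ n z' t ∩ {ω | Z n ω = z ∧ s < τ n ω ∧ Z (n + 1) ω = w} =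
          cylinder Z τ n z' t ∩ {ω | s < τ n ω ∧ Z (n + 1) ω = w} := by
        ext ω
        exact ⟨fun h => ⟨h.1, h.2.2⟩, fun h => ⟨h.1, (h.1.1 n le_rfl).trans hz, h.2⟩⟩
      have e2 : cylinder Z τ n z' t ∩ {ω | Z n ω = z} = cylinder Z τ n z' t :=
        Set.inter_eq_left.2 fun ω h => (h.1 n le_rfl).trans hz
      rw [e1, e2, h.markov_cylinder hlam, hz, hc]
      ring
    · have e1 : cylinder Z τ n z' t ∩ {ω | Z n ω = z ∧ s < τ n ω ∧ Z (n + 1) ω = w} = ∅ :=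
        Set.eq_empty_of_forall_notMem fun ω h => hz ((h.1.1 n le_rfl).symm.trans h.2.1)
      have e2 : cylinder Z τ n z' t ∩ {ω | Z n ω = z} = ∅ :=
        Set.eq_empty_of_forall_notMem fun ω h => hz ((h.1.1 n le_rfl).symm.trans h.2)
      rw [e1, e2]
      simp

/-- The Markov property: given the past, the next holding time is exponential and independent of
the next jump. -/
lemma HasJumpLaw.markov (h : HasJumpLaw lam P Z τ) (hlam : ∀ y ∈ jumps, 0 < lam y)
    (n : ℕ) (z w : ℕ × ℕ) {A : Set ℝ} (hA : MeasurableSet A) {E : Set Ω}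
    (hE : MeasurableSet[past Z τ n] E) :
    P (E ∩ {ω | Z n ω = z ∧ τ n ω ∈ A ∧ Z (n + 1) ω = w}) =
      P (E ∩ {ω | Z n ω = z}) * (ENNReal.ofReal (jumpProb lam z (displacement z w)) *
        expMeasure (totalIntensity lam z) A) := by
  have := isProbabilityMeasure_expMeasure (totalIntensity_pos hlam z)
  have hEm := h.past_le n _ hE
  have hmz : MeasurableSet {ω | Z n ω = z} := h.measurable_state n (measurableSet_singleton z)
  have hmw : MeasurableSet {ω | Z (n + 1) ω = w} :=
    h.measurable_state (n + 1) (measurableSet_singleton w)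
  have key : ∀ A, MeasurableSet A → ((P.restrict (E ∩ {ω | Z n ω = z} ∩ {ω | Z (n + 1) ω = w})).map (τ n)) A =
      P (E ∩ {ω | Z n ω = z ∧ τ n ω ∈ A ∧ Z (n + 1) ω = w}) := by
    intro A hA
    rw [Measure.map_apply (h.measurable_time n) hA, Measure.restrict_apply (h.measurable_time n hA)]
    congr 1
    ext ω
    simp only [Set.mem_inter_iff, Set.mem_preimage, Set.mem_ofPred_eq]
    tauto
  suffices (P.restrict (E ∩ {ω | Z n ω = z} ∩ {ω | Z (n + 1) ω = w})).map (τ n) =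
      (P (E ∩ {ω | Z n ω = z}) * ENNReal.ofReal (jumpProb lam z (displacement z w))) •
        expMeasure (totalIntensity lam z) by
    rw [← key A hA, this, Measure.smul_apply, smul_eq_mul]
    ring
  -- The same uniqueness argument in the time variable: open half-lines form a π-system generating
  -- the Borel sets.
  refine Measure.ext_of_generateFrom_of_cover_subset (S := Set.range Set.Ioi)
    (T := Set.range fun k : ℕ => Set.Ioi (-(k : ℝ)))
    ((BorelSpace.measurable_eq).trans (borel_eq_generateFrom_Ioi ℝ)) isPiSystem_Ioi ?_
    (Set.countable_range _) ?_ ?_ ?_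
  · rintro _ ⟨k, rfl⟩
    exact ⟨_, rfl⟩
  · refine Set.eq_univ_of_forall fun x => ?_
    obtain ⟨m, hm⟩ := exists_nat_gt (-x)
    exact ⟨_, ⟨m, rfl⟩, by simp only [Set.mem_Ioi]; linarith⟩
  · rintro _ ⟨k, rfl⟩
    exact measure_ne_top _ _
  · rintro _ ⟨s, rfl⟩
    rw [key _ measurableSet_Ioi]
    simp only [Set.mem_Ioi]
    rw [h.markov_Ioi hlam n z w s hE, Measure.smul_apply, smul_eq_mul]
    ring

/-- The Markov property for integrals. -/
lemma HasJumpLaw.lintegral_markov (h : HasJumpLaw lam P Z τ) (hlam : ∀ y ∈ jumps, 0 < lam y)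
    (n : ℕ) (z w : ℕ × ℕ) {G : Ω → ℝ≥0∞} (hG : Measurable[past Z τ n] G) {φ : ℝ → ℝ≥0∞}
    (hφ : Measurable φ) :
    ∫⁻ ω in {ω | Z n ω = z ∧ Z (n + 1) ω = w}, G ω * φ (τ n ω) ∂P =
      (∫⁻ ω in {ω | Z n ω = z}, G ω ∂P) * (ENNReal.ofReal (jumpProb lam z (displacement z w)) *
        ∫⁻ t, φ t ∂(expMeasure (totalIntensity lam z))) := by
  have hle := h.past_le n
  have hGm : Measurable G := hG.mono hle le_rfl
  have hmz : MeasurableSet {ω | Z n ω = z} := h.measurable_state n (measurableSet_singleton z)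
  have hmw : MeasurableSet {ω | Z (n + 1) ω = w} :=
    h.measurable_state (n + 1) (measurableSet_singleton w)
  have step : ∀ A, MeasurableSet A → ∫⁻ ω in {ω | Z n ω = z ∧ τ n ω ∈ A ∧ Z (n + 1) ω = w}, G ω ∂P =
      (ENNReal.ofReal (jumpProb lam z (displacement z w)) *
        expMeasure (totalIntensity lam z) A) * ∫⁻ ω in {ω | Z n ω = z}, G ω ∂P := by
    intro A hA
    set c := ENNReal.ofReal (jumpProb lam z (displacement z w)) *
        expMeasure (totalIntensity lam z) A with hc
    have : (P.restrict {ω | Z n ω = z ∧ τ n ω ∈ A ∧ Z (n + 1) ω = w}).trim hle =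
        (c • P.restrict {ω | Z n ω = z}).trim hle := by
      refine @Measure.ext _ (past Z τ n) _ _ fun E hE => ?_
      rw [trim_measurableSet_eq hle hE, trim_measurableSet_eq hle hE, Measure.smul_apply,
        Measure.restrict_apply (hle _ hE), Measure.restrict_apply (hle _ hE), smul_eq_mul,
        h.markov hlam n z w hA hE, mul_comm]
    rw [← lintegral_trim hle hG, this, lintegral_trim hle hG, lintegral_smul_measure, smul_eq_mul]
  have hB : MeasurableSet {ω | Z n ω = z ∧ Z (n + 1) ω = w} := hmz.inter hmw
  -- Weighting by `G` and pushing forward by `τ n` turns the identities `step` into one equality of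
  -- measures on the line, against which `φ` can be integrated.
  have hν : ((P.restrict {ω | Z n ω = z ∧ Z (n + 1) ω = w}).withDensity G).map (τ n) =
      (ENNReal.ofReal (jumpProb lam z (displacement z w)) * ∫⁻ ω in {ω | Z n ω = z}, G ω ∂P) •
        expMeasure (totalIntensity lam z) := by
    ext A hA
    rw [Measure.map_apply (h.measurable_time n) hA, withDensity_apply _ (h.measurable_time n hA),
      Measure.restrict_restrict (h.measurable_time n hA), Measure.smul_apply, smul_eq_mul]
    have : τ n ⁻¹' A ∩ {ω | Z n ω = z ∧ Z (n + 1) ω = w} =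
        {ω | Z n ω = z ∧ τ n ω ∈ A ∧ Z (n + 1) ω = w} := by
      ext ω
      simp only [Set.mem_inter_iff, Set.mem_preimage, Set.mem_ofPred_eq]
      tauto
    rw [this, step A hA]
    ring
  have h3 : ∫⁻ ω in {ω | Z n ω = z ∧ Z (n + 1) ω = w}, G ω * φ (τ n ω) ∂P =
      ∫⁻ t, φ t ∂(((P.restrict {ω | Z n ω = z ∧ Z (n + 1) ω = w}).withDensity G).map (τ n)) := by
    rw [lintegral_map hφ (h.measurable_time n)]
    exact (lintegral_withDensity_eq_lintegral_mul _ hGm (hφ.comp (h.measurable_time n))).symm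
  rw [h3, hν, lintegral_smul_measure, smul_eq_mul]
  ring

/-- One step of a weighted expectation along the jump chain. -/
lemma HasJumpLaw.lintegral_step_le (h : HasJumpLaw lam P Z τ) (hlam : ∀ y ∈ jumps, 0 < lam y)
    (n : ℕ) {G : Ω → ℝ≥0∞} (hG : Measurable[past Z τ n] G) {φ : ℕ × ℕ → ℝ → ℝ≥0∞}
    (hφ : ∀ z, Measurable (φ z)) (u v : ℕ × ℕ → ℝ≥0∞)
    (huv : ∀ z, (∑' w, ENNReal.ofReal (jumpProb lam z (displacement z w)) * v w) *
      ∫⁻ t, φ z t ∂(expMeasure (totalIntensity lam z)) ≤ u z) :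
    ∫⁻ ω, G ω * φ (Z n ω) (τ n ω) * v (Z (n + 1) ω) ∂P ≤ ∫⁻ ω, G ω * u (Z n ω) ∂P := by
  have hmz : ∀ n z, MeasurableSet {ω | Z n ω = z} :=
    fun n z => h.measurable_state n (measurableSet_singleton z)
  have decomp : ∀ f : Ω → ℝ≥0∞, ∫⁻ ω, f ω ∂P = ∑' z, ∫⁻ ω in {ω | Z n ω = z}, f ω ∂P := by
    intro f
    rw [← lintegral_iUnion (hmz n), Set.iUnion_eq_univ_iff.2 fun ω => ⟨Z n ω, rfl⟩,
      Measure.restrict_univ]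
    intro z z' hne
    exact Set.disjoint_left.2 fun ω h1 h2 => hne (h1.symm.trans h2)
  have decomp2 : ∀ (z : ℕ × ℕ) (f : Ω → ℝ≥0∞), ∫⁻ ω in {ω | Z n ω = z}, f ω ∂P =
      ∑' w, ∫⁻ ω in {ω | Z n ω = z ∧ Z (n + 1) ω = w}, f ω ∂P := by
    intro z f
    rw [← lintegral_iUnion (s := fun w => {ω | Z n ω = z ∧ Z (n + 1) ω = w})
      (fun w => (hmz n z).inter (hmz (n + 1) w))]
    · congr 2
      ext ω
      simp
    intro w w' hne
    exact Set.disjoint_left.2 fun ω h1 h2 => hne (h1.2.symm.trans h2.2)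
  rw [decomp, decomp]
  refine ENNReal.tsum_le_tsum fun z => ?_
  have hGm : Measurable G := hG.mono (h.past_le n) le_rfl
  have hr : ∫⁻ ω in {ω | Z n ω = z}, G ω * u (Z n ω) ∂P =
      (∫⁻ ω in {ω | Z n ω = z}, G ω ∂P) * u z := by
    rw [← lintegral_mul_const _ hGm]
    refine setLIntegral_congr_fun (hmz n z) fun ω hω => ?_
    have : Z n ω = z := hω
    simp only [this]
  have hl : ∀ w, ∫⁻ ω in {ω | Z n ω = z ∧ Z (n + 1) ω = w},
      G ω * φ (Z n ω) (τ n ω) * v (Z (n + 1) ω) ∂P =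
      (∫⁻ ω in {ω | Z n ω = z}, G ω ∂P) * ((ENNReal.ofReal (jumpProb lam z (displacement z w)) * v w) *
        ∫⁻ t, φ z t ∂(expMeasure (totalIntensity lam z))) := by
    intro w
    have : ∫⁻ ω in {ω | Z n ω = z ∧ Z (n + 1) ω = w},
        G ω * φ (Z n ω) (τ n ω) * v (Z (n + 1) ω) ∂P =
        ∫⁻ ω in {ω | Z n ω = z ∧ Z (n + 1) ω = w}, G ω * φ z (τ n ω) * v w ∂P := by
      refine setLIntegral_congr_fun ((hmz n z).inter (hmz (n + 1) w)) fun ω hω => ?_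
      have h1 : Z n ω = z := hω.1
      have h2 : Z (n + 1) ω = w := hω.2
      simp only [h1, h2]
    have hm : Measurable fun ω => G ω * φ z (τ n ω) := hGm.mul ((hφ z).comp (h.measurable_time n))
    rw [this, lintegral_mul_const _ hm,
      h.lintegral_markov hlam n z w hG (hφ z)]
    ring
  rw [decomp2, hr]
  simp_rw [hl]
  rw [ENNReal.tsum_mul_left, ENNReal.tsum_mul_right]
  exact mul_le_mul_right (huv z) _

/-- A weighted expectation along the jump chain decays geometrically if one step contracts. -/
lemma HasJumpLaw.lintegral_prod_le (h : HasJumpLaw lam P Z τ) (hlam : ∀ y ∈ jumps, 0 < lam y)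
    {φ : ℕ × ℕ → ℝ → ℝ≥0∞} (hφ : ∀ z, Measurable (φ z)) (v : ℕ × ℕ → ℝ≥0∞) (ρ : ℝ≥0∞)
    (hv : ∀ z, (∑' w, ENNReal.ofReal (jumpProb lam z (displacement z w)) * v w) *
      ∫⁻ t, φ z t ∂(expMeasure (totalIntensity lam z)) ≤ ρ * v z) (n : ℕ) :
    ∫⁻ ω, (∏ i ∈ Finset.range n, φ (Z i ω) (τ i ω)) * v (Z n ω) ∂P ≤ ρ ^ n * v (0, 0) := by
  induction n with
  | zero =>
    have h0 : ∀ᵐ ω ∂P, Z 0 ω = (0, 0) := by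
      have := h.law 0 (fun _ => (0, 0)) 0 (fun _ => le_rfl)
      simp only [Nat.le_zero, forall_eq, not_lt_zero, IsEmpty.forall_iff, implies_true, and_true,
        Finset.range_zero, Finset.prod_empty, ENNReal.ofReal_one, if_true] at this
      exact (mem_ae_iff_prob_eq_one (h.measurable_state 0 (measurableSet_singleton _))).2 this
    simp only [Finset.range_zero, Finset.prod_empty, one_mul, pow_zero]
    rw [lintegral_congr_ae (g := fun _ => v (0, 0)) (by filter_upwards [h0] with ω hω; rw [hω])]
    simp
  | succ n ih =>
    simp_rw [Finset.prod_range_succ]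
    refine (h.lintegral_step_le hlam n (measurable_past_prod hφ n) hφ
      (fun z => ρ * v z) v hv).trans ?_
    have : ∀ ω, (∏ i ∈ Finset.range n, φ (Z i ω) (τ i ω)) * (ρ * v (Z n ω)) =
        ρ * ((∏ i ∈ Finset.range n, φ (Z i ω) (τ i ω)) * v (Z n ω)) := fun ω => by ring
    simp_rw [this]
    rw [lintegral_const_mul]
    · calc _ ≤ ρ * (ρ ^ n * v (0, 0)) := mul_le_mul_right ih _
        _ = _ := by ring
    · exact ((measurable_past_prod hφ n).mono (h.past_le n) le_rfl).mul
        ((Measurable.of_discrete (f := v)).comp (h.measurable_state n))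

end MarkovGeneral

/-! ### Exponential Chebyshev bounds along the jump chain. -/

/-- The total intensity of the downward jumps. -/
noncomputable def downIntensity (lam : ℤ × ℤ → ℝ) (z : ℕ × ℕ) : ℝ :=
  z.1 * lam (-1, 0) + z.2 * lam (0, -1) + ((min z.1 z.2 : ℕ) : ℝ) * lam (-1, -1)

lemma totalIntensity_eq_add (lam : ℤ × ℤ → ℝ) (z : ℕ × ℕ) :
    totalIntensity lam z = lam (1, 0) + lam (0, 1) + downIntensity lam z :=
  totalIntensity_eq lam z

lemma downIntensity_nonneg {lam : ℤ × ℤ → ℝ} (hlam : ∀ y ∈ jumps, 0 < lam y) (z : ℕ × ℕ) :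
    0 ≤ downIntensity lam z := by
  obtain ⟨h1, h2, h3, h4, h5⟩ := lam_pos hlam
  unfold downIntensity
  positivity

/-- An upward jump multiplies the weight `β ^ (z₁ + z₂)` by `β`; a downward one divides it by at
least `β`. The diagonal jump divides by `β²`, which is where `1 ≤ β` enters. -/
lemma tsum_jumpProb_pow_le {lam : ℤ × ℤ → ℝ} (hlam : ∀ y ∈ jumps, 0 < lam y) (z : ℕ × ℕ) {β : ℝ}
    (hβ : 1 ≤ β) :
    ∑' w, ENNReal.ofReal (jumpProb lam z (displacement z w)) * ENNReal.ofReal (β ^ (w.1 + w.2)) ≤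
      ENNReal.ofReal (((lam (1, 0) + lam (0, 1)) * β + downIntensity lam z / β) *
        β ^ (z.1 + z.2) / totalIntensity lam z) := by
  obtain ⟨h1, h2, h3, h4, h5⟩ := lam_pos hlam
  have hβ0 : 0 < β := by linarith
  rw [tsum_jumpProb_mul hlam, tsum_intensity_mul, ENNReal.ofReal_div_of_pos (totalIntensity_pos hlam z)]
  refine ENNReal.div_le_div_right ?_ _
  simp only
  rw [← ENNReal.ofReal_mul h1.le, ← ENNReal.ofReal_mul h2.le, ← ENNReal.ofReal_mul (by positivity),
    ← ENNReal.ofReal_mul (by positivity), ← ENNReal.ofReal_mul (by positivity),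
    ← ENNReal.ofReal_add, ← ENNReal.ofReal_add, ← ENNReal.ofReal_add, ← ENNReal.ofReal_add] <;>
    try positivity
  refine ENNReal.ofReal_le_ofReal ?_
  obtain ⟨a, b⟩ := z
  have e3 : (a : ℝ) * lam (-1, 0) * β ^ (a - 1 + b) ≤ a * lam (-1, 0) * (β ^ (a + b) / β) := by
    rcases a with _ | a
    · simp
    · refine mul_le_mul_of_nonneg_left ?_ (by positivity)
      rw [le_div_iff₀ hβ0, ← pow_succ]
      exact le_of_eq (by congr 1; omega)
  have e4 : (b : ℝ) * lam (0, -1) * β ^ (a + (b - 1)) ≤ b * lam (0, -1) * (β ^ (a + b) / β) := by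
    rcases b with _ | b
    · simp
    · refine mul_le_mul_of_nonneg_left ?_ (by positivity)
      rw [le_div_iff₀ hβ0, ← pow_succ]
      exact le_of_eq (by congr 1)
  have e5 : ((min a b : ℕ) : ℝ) * lam (-1, -1) * β ^ (a - 1 + (b - 1)) ≤
      ((min a b : ℕ) : ℝ) * lam (-1, -1) * (β ^ (a + b) / β) := by
    rcases a with _ | a
    · simp
    rcases b with _ | b
    · simp
    refine mul_le_mul_of_nonneg_left ?_ (by positivity)
    rw [le_div_iff₀ hβ0, ← pow_succ]
    exact pow_le_pow_right₀ hβ (by omega)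
  have e1 : β ^ (a + 1 + b) = β ^ (a + b) * β := by rw [← pow_succ]; congr 1; omega
  have e2 : β ^ (a + (b + 1)) = β ^ (a + b) * β := by rw [← pow_succ]; congr 1
  simp only [downIntensity]
  rw [e1, e2]
  have : (((lam (1, 0) + lam (0, 1)) * β + ((a : ℝ) * lam (-1, 0) + b * lam (0, -1) +
      ((min a b : ℕ) : ℝ) * lam (-1, -1)) / β) * β ^ (a + b)) =
      lam (1, 0) * (β ^ (a + b) * β) + lam (0, 1) * (β ^ (a + b) * β) +
      a * lam (-1, 0) * (β ^ (a + b) / β) + b * lam (0, -1) * (β ^ (a + b) / β) +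
      ((min a b : ℕ) : ℝ) * lam (-1, -1) * (β ^ (a + b) / β) := by ring
  rw [this]
  linarith

/-- The moment generating function `h / (h - b)` cancels the `1 / h` of the jump probabilities, so
the step multiplies the weight by at most `(lβ + d/β) / (h - b)`, with `l` and `d` the upward and
downward intensities. -/
lemma tsum_jumpProb_pow_mul_exp_le {lam : ℤ × ℤ → ℝ} (hlam : ∀ y ∈ jumps, 0 < lam y) (z : ℕ × ℕ)
    {β b : ℝ} (hβ : 1 ≤ β) (hb : b < totalIntensity lam z)
    (h : (lam (1, 0) + lam (0, 1)) * β + downIntensity lam z / β ≤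
      (totalIntensity lam z - b) / 2) :
    (∑' w, ENNReal.ofReal (jumpProb lam z (displacement z w)) * ENNReal.ofReal (β ^ (w.1 + w.2))) *
      ∫⁻ t, ENNReal.ofReal (Real.exp (b * t)) ∂(expMeasure (totalIntensity lam z)) ≤
      2⁻¹ * ENNReal.ofReal (β ^ (z.1 + z.2)) := by
  have hpos := totalIntensity_pos hlam z
  have hd := downIntensity_nonneg hlam z
  obtain ⟨h1, h2, -⟩ := lam_pos hlam
  have hb' : 0 < totalIntensity lam z - b := by linarith
  rw [lintegral_exp_expMeasure hpos hb]
  refine (mul_le_mul_left (tsum_jumpProb_pow_le hlam z hβ) _).trans ?_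
  have : (2⁻¹ : ℝ≥0∞) = ENNReal.ofReal (2⁻¹) := by
    rw [ENNReal.ofReal_inv_of_pos two_pos]; simp
  rw [this, ← ENNReal.ofReal_mul (by positivity), ← ENNReal.ofReal_mul (by positivity)]
  refine ENNReal.ofReal_le_ofReal ?_
  have e : ((lam (1, 0) + lam (0, 1)) * β + downIntensity lam z / β) * β ^ (z.1 + z.2) /
      totalIntensity lam z * (totalIntensity lam z / (totalIntensity lam z - b)) =
      ((lam (1, 0) + lam (0, 1)) * β + downIntensity lam z / β) / (totalIntensity lam z - b) *
        β ^ (z.1 + z.2) := by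
    field_simp
  rw [e]
  refine mul_le_mul_of_nonneg_right ?_ (by positivity)
  rw [div_le_iff₀ hb']
  linarith

section Upper

variable {Ω : Type*} [MeasurableSpace Ω] {lam : ℤ × ℤ → ℝ} {P : Measure Ω}
  {Z : ℕ → Ω → ℕ × ℕ} {τ : ℕ → Ω → ℝ} [IsProbabilityMeasure P]

/-- The process does not explode. -/
lemma HasJumpLaw.ae_exists_lt_sum (h : HasJumpLaw lam P Z τ) (hlam : ∀ y ∈ jumps, 0 < lam y) :
    ∀ᵐ ω ∂P, ∀ k : ℕ, ∃ n, (k : ℝ) < ∑ i ∈ Finset.range n, τ i ω := by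
  rw [ae_all_iff]
  intro k
  obtain ⟨h1, h2, -⟩ := lam_pos hlam
  -- With `β = 2` and `b = -a` the contraction condition is `2l + d/2 ≤ (l + d + a)/2`, for which `a
  -- = 4l` is enough.
  set a := 4 * (lam (1, 0) + lam (0, 1)) with ha
  have ha0 : 0 < a := by positivity
  have hz : ∀ z, (∑' w, ENNReal.ofReal (jumpProb lam z (displacement z w)) *
      ENNReal.ofReal (2 ^ (w.1 + w.2))) *
      ∫⁻ t, ENNReal.ofReal (Real.exp (-a * t)) ∂(expMeasure (totalIntensity lam z)) ≤
      2⁻¹ * ENNReal.ofReal (2 ^ (z.1 + z.2)) := by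
    intro z
    have hpos := totalIntensity_pos hlam z
    have hd := downIntensity_nonneg hlam z
    refine tsum_jumpProb_pow_mul_exp_le hlam z one_le_two (by linarith) ?_
    rw [totalIntensity_eq_add, ha]
    linarith
  have hn := h.lintegral_prod_le hlam (φ := fun _ t => ENNReal.ofReal (Real.exp (-a * t)))
    (fun _ => by fun_prop) (fun z => ENNReal.ofReal (2 ^ (z.1 + z.2))) 2⁻¹ hz
  -- The event does not depend on the outer `n`, so the geometric factor forces its probability to
  -- be zero.
  have bound : ∀ n, P {ω | ¬ ∃ n, (k : ℝ) < ∑ i ∈ Finset.range n, τ i ω} ≤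
      ENNReal.ofReal (Real.exp (a * k)) * (2⁻¹) ^ n := by
    intro n
    calc P {ω | ¬ ∃ n, (k : ℝ) < ∑ i ∈ Finset.range n, τ i ω}
        ≤ ∫⁻ ω, ENNReal.ofReal (Real.exp (a * k)) *
          ((∏ i ∈ Finset.range n, ENNReal.ofReal (Real.exp (-a * τ i ω))) *
            ENNReal.ofReal (2 ^ ((Z n ω).1 + (Z n ω).2))) ∂P := by
          refine meas_le_lintegral₀ ?_ fun ω hω => ?_
          · have h1 : Measurable fun ω => ENNReal.ofReal ((2 : ℝ) ^ ((Z n ω).1 + (Z n ω).2)) :=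
              (Measurable.of_discrete (f := fun z : ℕ × ℕ => ENNReal.ofReal ((2 : ℝ) ^ (z.1 + z.2)))).comp
                (h.measurable_state n)
            have h2 : Measurable fun ω => ∏ i ∈ Finset.range n,
                ENNReal.ofReal (Real.exp (-a * τ i ω)) :=
              Finset.measurable_prod _ fun i _ => by have := h.measurable_time i; fun_prop
            exact ((h2.mul h1).const_mul _).aemeasurable
          · have hω' : ∑ i ∈ Finset.range n, τ i ω ≤ k := by
              by_contra hc
              exact hω ⟨n, not_le.1 hc⟩
            rw [← ENNReal.ofReal_prod_of_nonneg (fun i _ => (Real.exp_pos _).le),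
              ← ENNReal.ofReal_mul (Finset.prod_nonneg fun i _ => (Real.exp_pos _).le),
              ← ENNReal.ofReal_mul (Real.exp_pos _).le, ← Real.exp_sum, ← mul_assoc, ← Real.exp_add,
              ENNReal.one_le_ofReal, ← Finset.mul_sum]
            refine one_le_mul_of_one_le_of_one_le ?_ (one_le_pow₀ one_le_two)
            rw [Real.one_le_exp_iff]
            nlinarith
      _ ≤ ENNReal.ofReal (Real.exp (a * k)) * ((2⁻¹) ^ n * 1) := by
          rw [lintegral_const_mul']
          · refine mul_le_mul_right ((hn n).trans ?_) _
            simp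
          · exact ENNReal.ofReal_ne_top
      _ = _ := by rw [mul_one]
  have hlim : Tendsto (fun n : ℕ => ENNReal.ofReal (Real.exp (a * k)) * (2⁻¹ : ℝ≥0∞) ^ n) atTop
      (𝓝 0) := by
    have := ENNReal.Tendsto.const_mul (a := ENNReal.ofReal (Real.exp (a * k)))
      (ENNReal.tendsto_pow_atTop_nhds_zero_of_lt_one (r := 2⁻¹) (by simp)) (Or.inr ENNReal.ofReal_ne_top)
    simpa using this
  exact le_antisymm (ge_of_tendsto' hlim bound) zero_le

/-- An exponential Chebyshev bound for events determined by the first `n + 1` holding times. -/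
lemma HasJumpLaw.measure_le_of_one_le (h : HasJumpLaw lam P Z τ) (hlam : ∀ y ∈ jumps, 0 < lam y)
    {φ ψ : ℕ × ℕ → ℝ → ℝ≥0∞} (hφ : ∀ z, Measurable (φ z)) (hψ : ∀ z, Measurable (ψ z))
    (v : ℕ × ℕ → ℝ≥0∞) {ρ c K : ℝ≥0∞} (hc : c ≠ ∞) (hK : K ≠ ∞)
    (hv : ∀ z, (∑' w, ENNReal.ofReal (jumpProb lam z (displacement z w)) * v w) *
      ∫⁻ t, φ z t ∂(expMeasure (totalIntensity lam z)) ≤ ρ * v z)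
    (hvc : ∀ z, ∫⁻ t, ψ z t ∂(expMeasure (totalIntensity lam z)) ≤ c * v z) (n : ℕ) {s : Set Ω}
    (hs : ∀ ω ∈ s, 1 ≤ K * ((∏ i ∈ Finset.range n, φ (Z i ω) (τ i ω)) * ψ (Z n ω) (τ n ω))) :
    P s ≤ K * (c * (ρ ^ n * v (0, 0))) := by
  have hG : Measurable[past Z τ n] fun ω => ∏ i ∈ Finset.range n, φ (Z i ω) (τ i ω) :=
    measurable_past_prod hφ n
  have hGm : Measurable fun ω => ∏ i ∈ Finset.range n, φ (Z i ω) (τ i ω) :=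
    hG.mono (h.past_le n) le_rfl
  have h1 : Measurable fun p : (ℕ × ℕ) × ℝ => ψ p.1 p.2 := measurable_from_prod_countable_right hψ
  have h2 : Measurable fun ω => ψ (Z n ω) (τ n ω) :=
    h1.comp ((h.measurable_state n).prodMk (h.measurable_time n))
  calc P s ≤ ∫⁻ ω, K * ((∏ i ∈ Finset.range n, φ (Z i ω) (τ i ω)) * ψ (Z n ω) (τ n ω)) ∂P :=
        meas_le_lintegral₀ (measurable_const.mul (hGm.mul h2)).aemeasurable hs
    _ ≤ K * ∫⁻ ω, (∏ i ∈ Finset.range n, φ (Z i ω) (τ i ω)) * (c * v (Z n ω)) ∂P := by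
        rw [lintegral_const_mul' _ _ hK]
        have := h.lintegral_step_le hlam n hG hψ (fun z => c * v z) (fun _ => 1)
          (by simpa [tsum_jumpProb hlam] using hvc)
        simp only [mul_one] at this
        exact mul_le_mul_right this _
    _ = K * (c * ∫⁻ ω, (∏ i ∈ Finset.range n, φ (Z i ω) (τ i ω)) * v (Z n ω) ∂P) := by
        rw [← lintegral_const_mul' _ _ hc]
        congr 2
        ext ω
        ring
    _ ≤ _ := mul_le_mul_right (mul_le_mul_right (h.lintegral_prod_le hlam hφ v ρ hv n) _) _

/-- The upper bound for the probability that the process collects a given amount of intensity up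
to the time `T` while its downward intensity stays of order `T`. -/
lemma HasJumpLaw.measure_le_exp (h : HasJumpLaw lam P Z τ) (hlam : ∀ y ∈ jumps, 0 < lam y)
    {T C H : ℝ} (hT : 1 ≤ T) (hC : 0 ≤ C) (ok : Set (ℕ × ℕ))
    (hok : ∀ z ∈ ok, downIntensity lam z ≤ C * T) :
    P {ω | (∀ i, 0 < τ i ω) ∧ ∃ n, ∑ i ∈ Finset.range n, τ i ω ≤ T ∧
        T < ∑ i ∈ Finset.range (n + 1), τ i ω ∧ (∀ i ≤ n, Z i ω ∈ ok) ∧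
        H ≤ ∑ i ∈ Finset.range n, totalIntensity lam (Z i ω) * τ i ω +
          totalIntensity lam (Z n ω) * (T - ∑ i ∈ Finset.range n, τ i ω)} ≤
      ENNReal.ofReal (2 * T ^ 2 * Real.exp (-H + 2 * (lam (1, 0) + lam (0, 1) + C) * √T * T +
        (lam (1, 0) + lam (0, 1) + C))) := by
  classical
  obtain ⟨hl1, hl2, -⟩ := lam_pos hlam
  set l := lam (1, 0) + lam (0, 1) with hl
  have hl0 : 0 < l := by positivity
  -- With the weight base `√T`, the upward part `l√T` and, on `ok`, the downward part `CT/√T` are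
  -- both of order `√T`. This `a` makes the contraction factor `1/2` and costs only `exp (aT)` over
  -- the time `T`.
  set a := 2 * (l + C) * √T with ha
  have hsq : 1 ≤ √T := by rwa [Real.one_le_sqrt]
  have hsq2 : √T * √T = T := Real.mul_self_sqrt (by linarith)
  have ha0 : 0 < a := by positivity
  -- The last, incomplete holding time cannot carry the exponent `h` itself, whose moment generating
  -- function diverges. With `θh` it equals `T²`, and the exponent loses at most `l + C` because `h`
  -- is at most `(l + C)T`.
  set θ := 1 - 1 / T ^ 2 with hθ
  have hT2 : 0 < 1 / T ^ 2 := by positivity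
  have hθ0 : 0 ≤ θ := by
    rw [hθ, sub_nonneg, div_le_one (by positivity)]
    exact one_le_pow₀ hT
  -- Letting the weight vanish off `ok` builds the constraint into it, and the contraction is
  -- trivial there.
  set φ : ℕ × ℕ → ℝ → ℝ≥0∞ := fun z t =>
    if z ∈ ok then ENNReal.ofReal (Real.exp ((totalIntensity lam z - a) * t)) else 0 with hφ
  set ψ : ℕ × ℕ → ℝ → ℝ≥0∞ := fun z t =>
    ENNReal.ofReal (Real.exp (θ * totalIntensity lam z * t)) with hψ
  have hφm : ∀ z, Measurable (φ z) := fun z => by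
    simp only [hφ]; split_ifs <;> fun_prop
  have hψm : ∀ z, Measurable (ψ z) := fun z => by simp only [hψ]; fun_prop
  have hz : ∀ z, (∑' w, ENNReal.ofReal (jumpProb lam z (displacement z w)) *
      ENNReal.ofReal (√T ^ (w.1 + w.2))) *
      ∫⁻ t, φ z t ∂(expMeasure (totalIntensity lam z)) ≤
      2⁻¹ * ENNReal.ofReal (√T ^ (z.1 + z.2)) := by
    intro z
    by_cases hzok : z ∈ ok
    · simp only [hφ, if_pos hzok]
      refine tsum_jumpProb_pow_mul_exp_le hlam z hsq (by linarith) ?_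
      have : downIntensity lam z / √T ≤ C * √T := by
        rw [div_le_iff₀ (by linarith), mul_assoc, hsq2]
        exact hok z hzok
      rw [← hl, ha]
      linarith
    · simp [hφ, if_neg hzok]
  set K : ℝ≥0∞ := ENNReal.ofReal (Real.exp (-H + a * T + (l + C))) with hK
  have hψ' : ∀ z, ∫⁻ t, ψ z t ∂(expMeasure (totalIntensity lam z)) ≤
      ENNReal.ofReal (T ^ 2) * ENNReal.ofReal (√T ^ (z.1 + z.2)) := by
    intro z
    have hpos := totalIntensity_pos hlam z
    simp only [hψ]
    rw [lintegral_exp_expMeasure hpos (by rw [hθ]; nlinarith),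
      ← ENNReal.ofReal_mul (by positivity)]
    refine ENNReal.ofReal_le_ofReal ?_
    have : totalIntensity lam z / (totalIntensity lam z - θ * totalIntensity lam z) = T ^ 2 := by
      rw [hθ]
      field_simp
      ring
    rw [this]
    exact le_mul_of_one_le_right (by positivity) (one_le_pow₀ hsq)
  have hEn : ∀ n, P {ω | (∀ i, 0 < τ i ω) ∧ ∑ i ∈ Finset.range n, τ i ω ≤ T ∧
        T < ∑ i ∈ Finset.range (n + 1), τ i ω ∧ (∀ i ≤ n, Z i ω ∈ ok) ∧
        H ≤ ∑ i ∈ Finset.range n, totalIntensity lam (Z i ω) * τ i ω +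
          totalIntensity lam (Z n ω) * (T - ∑ i ∈ Finset.range n, τ i ω)} ≤
      K * (ENNReal.ofReal (T ^ 2) * (2⁻¹) ^ n) := by
    intro n
    refine (h.measure_le_of_one_le hlam hφm hψm _ ENNReal.ofReal_ne_top ENNReal.ofReal_ne_top hz hψ' n
      (K := K) ?_).trans (by simp)
    rintro ω ⟨hpos, hS, hS', hZ, hH⟩
    have e : ∏ i ∈ Finset.range n, φ (Z i ω) (τ i ω) =
        ∏ i ∈ Finset.range n, ENNReal.ofReal (Real.exp ((totalIntensity lam (Z i ω) - a) * τ i ω)) :=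
      Finset.prod_congr rfl fun i hi => if_pos (hZ i (Finset.mem_range.1 hi).le)
    rw [e, ← ENNReal.ofReal_prod_of_nonneg (fun i _ => (Real.exp_pos _).le),
      ← Real.exp_sum, ← ENNReal.ofReal_mul (Real.exp_pos _).le,
      ← ENNReal.ofReal_mul (Real.exp_pos _).le, ← Real.exp_add, ← Real.exp_add,
      ENNReal.one_le_ofReal, Real.one_le_exp_iff]
    simp_rw [sub_mul]
    rw [Finset.sum_sub_distrib, ← Finset.mul_sum]
    set S := ∑ i ∈ Finset.range n, τ i ω with hSdef
    have hS0 : 0 ≤ S := Finset.sum_nonneg fun i _ => (hpos i).le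
    have hτ : T - S ≤ τ n ω := by
      rw [Finset.sum_range_succ, ← hSdef] at hS'
      linarith
    set hh := totalIntensity lam (Z n ω) with hhh
    have hh0 : 0 < hh := totalIntensity_pos hlam _
    have hhT : hh ≤ (l + C) * T := by
      have := hok _ (hZ n le_rfl)
      rw [hhh, totalIntensity_eq_add]
      nlinarith
    have b1 : hh * (T - S) ≤ θ * hh * τ n ω + (l + C) := by
      have c1 : θ * hh * (T - S) ≤ θ * hh * τ n ω :=
        mul_le_mul_of_nonneg_left hτ (by positivity)
      have c2 : 1 / T ^ 2 * (hh * (T - S)) ≤ l + C := by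
        have : hh * (T - S) ≤ (l + C) * T * T :=
          mul_le_mul hhT (by linarith) (by linarith) (by positivity)
        rw [one_div, inv_mul_le_iff₀ (by positivity)]
        linarith
      have c3 : hh * (T - S) = θ * hh * (T - S) + 1 / T ^ 2 * (hh * (T - S)) := by
        rw [hθ]; ring
      linarith
    have b2 : a * S ≤ a * T := mul_le_mul_of_nonneg_left hS ha0.le
    linarith
  -- The factors `2⁻ⁿ` pay for the union over the number of jumps before `T`.
  calc _ ≤ P (⋃ n, {ω | (∀ i, 0 < τ i ω) ∧ ∑ i ∈ Finset.range n, τ i ω ≤ T ∧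
        T < ∑ i ∈ Finset.range (n + 1), τ i ω ∧ (∀ i ≤ n, Z i ω ∈ ok) ∧
        H ≤ ∑ i ∈ Finset.range n, totalIntensity lam (Z i ω) * τ i ω +
          totalIntensity lam (Z n ω) * (T - ∑ i ∈ Finset.range n, τ i ω)}) := by
        refine measure_mono fun ω hω => ?_
        obtain ⟨hω1, n, hω2⟩ := hω
        exact Set.mem_iUnion.2 ⟨n, hω1, hω2⟩
    _ ≤ ∑' n : ℕ, K * (ENNReal.ofReal (T ^ 2) * (2⁻¹) ^ n) :=
        (measure_iUnion_le _).trans (ENNReal.tsum_le_tsum hEn)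
    _ = _ := by
        rw [ENNReal.tsum_mul_left, ENNReal.tsum_mul_left, ENNReal.tsum_geometric,
          ENNReal.one_sub_inv_two, inv_inv, hK,
          show (2 : ℝ≥0∞) = ENNReal.ofReal 2 by simp, ← ENNReal.ofReal_mul (by positivity),
          ← ENNReal.ofReal_mul (by positivity)]
        congr 1
        ring

end Upper

/-! ### The cost of a path and the upper bound for the strip. -/

/-- The rate at which the process, at the scaled position `(a, b)`, tends to jump downwards. -/
noncomputable def cost (lam : ℤ × ℤ → ℝ) (a b : ℝ) : ℝ :=
  lam (-1, 0) * a + lam (0, -1) * b + lam (-1, -1) * min a b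

/-- The cost of the lowest path in the strip at a given time. -/
noncomputable def truncCost (lam : ℤ × ℤ → ℝ) (f : unitInterval → ℝ × ℝ) (ε : ℝ)
    (t : unitInterval) : ℝ :=
  cost lam (max ((f t).1 - ε) 0) (max ((f t).2 - ε) 0)

/-- The total cost of the lowest path in the strip. -/
noncomputable def truncRate (lam : ℤ × ℤ → ℝ) (f : unitInterval → ℝ × ℝ) (ε : ℝ) : ℝ :=
  ∫ t, truncCost lam f ε t

lemma cost_mono {lam : ℤ × ℤ → ℝ} (hlam : ∀ y ∈ jumps, 0 < lam y) {a b a' b' : ℝ}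
    (ha : a ≤ a') (hb : b ≤ b') : cost lam a b ≤ cost lam a' b' := by
  obtain ⟨-, -, h3, h4, h5⟩ := lam_pos hlam
  unfold cost
  gcongr

/-- The minimum commutes with a common shift; so, with monotonicity, errors of size `d` in both
coordinates become linear errors in the cost. -/
lemma cost_add (lam : ℤ × ℤ → ℝ) (a b d : ℝ) :
    cost lam (a + d) (b + d) = cost lam a b + (lam (-1, 0) + lam (0, -1) + lam (-1, -1)) * d := by
  unfold cost
  rw [min_add_add_right]
  ring

lemma continuous_truncCost (lam : ℤ × ℤ → ℝ) {f : unitInterval → ℝ × ℝ} (hf : Continuous f) (ε : ℝ) :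
    Continuous (truncCost lam f ε) := by
  unfold truncCost cost
  fun_prop

lemma downIntensity_div (lam : ℤ × ℤ → ℝ) (z : ℕ × ℕ) {T : ℝ} (hT : 0 < T) :
    downIntensity lam z = T * cost lam (z.1 / T) (z.2 / T) := by
  unfold downIntensity cost
  rw [min_div_div_right hT.le]
  push_cast
  field_simp

lemma integral_unitInterval_eq {g : unitInterval → ℝ} :
    ∫ t, g t = ∫ s in (0 : ℝ)..1, Set.IccExtend zero_le_one g s := by
  rw [intervalIntegral.integral_of_le zero_le_one, ← integral_Icc_eq_integral_Ioc,
    ← integral_subtype_comap measurableSet_Icc]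
  refine integral_congr_ae (Eventually.of_forall fun t => ?_)
  simp only [Set.IccExtend_val]

/-- The integral of a function that is bounded by constants on consecutive intervals. -/
lemma integral_le_sum_mul_sub {g : ℝ → ℝ} (hg : Continuous g) {S : ℕ → ℝ} (hS : Monotone S)
    {a : ℕ → ℝ} {T : ℝ} {m : ℕ} (hm : S m ≤ T)
    (h : ∀ i < m, ∀ s, S i < s → s < S (i + 1) → g s ≤ a i)
    (h' : ∀ s, S m < s → s < T → g s ≤ a m) :
    ∫ s in (S 0)..T, g s ≤ ∑ i ∈ Finset.range m, a i * (S (i + 1) - S i) + a m * (T - S m) := by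
  have hi : ∀ x y, IntervalIntegrable g volume x y := fun x y => hg.intervalIntegrable x y
  have piece : ∀ x y c, x ≤ y → (∀ s, x < s → s < y → g s ≤ c) → ∫ s in x..y, g s ≤ c * (y - x) := by
    intro x y c hxy hc
    calc ∫ s in x..y, g s ≤ ∫ _ in x..y, c :=
          intervalIntegral.integral_mono_on_of_le_Ioo hxy (hi x y) intervalIntegrable_const
            fun s hs => hc s hs.1 hs.2
      _ = c * (y - x) := by rw [intervalIntegral.integral_const, smul_eq_mul, mul_comm]
  rw [← intervalIntegral.integral_add_adjacent_intervals (hi (S 0) (S m)) (hi (S m) T),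
    ← intervalIntegral.sum_integral_adjacent_intervals fun i _ => hi _ _]
  refine add_le_add (Finset.sum_le_sum fun i hi' => ?_) (piece _ _ _ hm h')
  exact piece _ _ _ (hS (Nat.le_succ i)) (h i (Finset.mem_range.1 hi'))

lemma scaledPath_div {Ω : Type*} (ξ : ℝ≥0 → Ω → ℕ × ℕ) {T : ℝ} (hT : 0 < T) (ω : Ω) {s : ℝ}
    (hs : 0 ≤ s) (hsT : s ≤ T) :
    scaledPath ξ T ω ⟨s / T, by positivity, div_le_one_of_le₀ hsT hT.le⟩ =
      (((ξ (Real.toNNReal s) ω).1 : ℝ) / T, ((ξ (Real.toNNReal s) ω).2 : ℝ) / T) := by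
  simp [scaledPath, div_mul_cancel₀ s hT.ne']

section Upper

variable {Ω : Type*} [MeasurableSpace Ω] {lam : ℤ × ℤ → ℝ} {P : Measure Ω}
  {Z : ℕ → Ω → ℕ × ℕ} {τ : ℕ → Ω → ℝ} [IsProbabilityMeasure P] {ξ : ℝ≥0 → Ω → ℕ × ℕ}

/-- The upper bound for the probability that the scaled path stays in a strip. -/
lemma HasJumpLaw.measure_stripEps_le (h : HasJumpLaw lam P Z τ) (hlam : ∀ y ∈ jumps, 0 < lam y)
    (hξ : ∀ᵐ ω ∂P, ∀ (n : ℕ) (t : ℝ≥0), ∑ i ∈ Finset.range n, τ i ω ≤ (t : ℝ) →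
      (t : ℝ) < ∑ i ∈ Finset.range (n + 1), τ i ω → ξ t ω = Z n ω)
    {f : unitInterval → ℝ × ℝ} (hf : Continuous f) {ε M T : ℝ} (hM : 0 ≤ M) (hT : 1 ≤ T) :
    P {ω | scaledPath ξ T ω ∈ stripEps f ε M} ≤
      ENNReal.ofReal (2 * T ^ 2 * Real.exp (-(T ^ 2 * truncRate lam f ε) +
        2 * (lam (1, 0) + lam (0, 1) + cost lam M M) * √T * T +
        (lam (1, 0) + lam (0, 1) + cost lam M M))) := by
  have hT0 : 0 < T := by linarith
  obtain ⟨hl1, hl2, hl3, hl4, hl5⟩ := lam_pos hlam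
  have hC : 0 ≤ cost lam M M := by
    unfold cost; rw [min_self]; positivity
  refine le_trans (measure_mono_ae ?_) (h.measure_le_exp hlam hT hC
    {z | downIntensity lam z ≤ cost lam M M * T} (fun z hz => hz))
  filter_upwards [h.ae_times_pos hlam, h.ae_exists_lt_sum hlam, hξ] with ω hpos hex hω hmem
  refine ⟨hpos, ?_⟩
  set S : ℕ → ℝ := fun n => ∑ i ∈ Finset.range n, τ i ω with hS
  have hSmono : StrictMono S := strictMono_nat_of_lt_succ fun n => by
    simp only [hS, Finset.sum_range_succ]; linarith [hpos n]
  have hS0 : S 0 = 0 := by simp [hS]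
  have hSnn : ∀ n, 0 ≤ S n := fun n => hS0 ▸ hSmono.monotone (Nat.zero_le n)
  have hexT : ∃ n, T < S n := by
    obtain ⟨k, hk⟩ := exists_nat_gt T
    obtain ⟨n, hn⟩ := hex k
    exact ⟨n, hk.trans hn⟩
  classical
  -- `m` is the number of jumps up to the time `T`, finite because the process does not explode.
  obtain ⟨m, hm⟩ : ∃ m, Nat.find hexT = m + 1 := by
    refine Nat.exists_eq_succ_of_ne_zero fun h0 => ?_
    have := Nat.find_spec hexT
    rw [h0, hS0] at this
    linarith
  have hm1 : T < S (m + 1) := hm ▸ Nat.find_spec hexT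
  have hm2 : S m ≤ T := not_lt.1 (Nat.find_min hexT (by omega))
  have hval : ∀ i s, S i ≤ s → s < S (i + 1) → ξ (Real.toNNReal s) ω = Z i ω := by
    intro i s h1 h2
    have hs : 0 ≤ s := (hSnn i).trans h1
    refine hω i _ ?_ ?_ <;> rwa [Real.coe_toNNReal _ hs]
  have hstrip : ∀ i s, S i ≤ s → s < S (i + 1) → (hsT : s ≤ T) →
      (T * Set.IccExtend zero_le_one (truncCost lam f ε) (s / T) ≤ totalIntensity lam (Z i ω)) ∧
      downIntensity lam (Z i ω) ≤ cost lam M M * T := by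
    intro i s h1 h2 hsT
    have hs : 0 ≤ s := (hSnn i).trans h1
    have hu : s / T ∈ Set.Icc (0 : ℝ) 1 := ⟨by positivity, div_le_one_of_le₀ hsT hT0.le⟩
    have := hmem.2 ⟨s / T, hu⟩
    rw [scaledPath_div ξ hT0 ω hs hsT, hval i s h1 h2] at this
    simp only at this
    rw [Set.IccExtend_of_mem _ _ hu, totalIntensity_eq_add, downIntensity_div lam _ hT0]
    constructor
    · have : truncCost lam f ε ⟨s / T, hu⟩ ≤ cost lam ((Z i ω).1 / T) ((Z i ω).2 / T) :=
        cost_mono hlam (max_le this.1.1 (by positivity)) (max_le this.2.1 (by positivity))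
      have := mul_le_mul_of_nonneg_left this hT0.le
      linarith
    · rw [mul_comm]
      exact mul_le_mul_of_nonneg_right (cost_mono hlam this.1.2 this.2.2) hT0.le
  refine ⟨m, hm2, hm1, fun i hi => ?_, ?_⟩
  · exact (hstrip i (S i) le_rfl (hSmono (Nat.lt_succ_self i))
      ((hSmono.monotone hi).trans hm2)).2
  · have hcont : Continuous fun s => T * Set.IccExtend zero_le_one (truncCost lam f ε) (s / T) :=
      continuous_const.mul (((continuous_truncCost lam hf ε).Icc_extend' (h := zero_le_one)).comp
        (continuous_id.div_const T))
    have key := integral_le_sum_mul_sub hcont hSmono.monotone (a := fun i => totalIntensity lam (Z i ω))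
      hm2 (fun i hi s h1 h2 => (hstrip i s h1.le h2
        (h2.le.trans ((hSmono.monotone (Nat.succ_le_of_lt hi)).trans hm2))).1)
      (fun s h1 h2 => (hstrip m s h1.le (h2.trans hm1) h2.le).1)
    have hτ : ∀ i, S (i + 1) - S i = τ i ω := fun i => by simp [hS, Finset.sum_range_succ]
    simp only [hτ] at key
    refine le_trans (le_of_eq ?_) key
    -- One factor `T` comes from the intensities, the other from rescaling time.
    rw [hS0, intervalIntegral.integral_const_mul, intervalIntegral.integral_comp_div _ hT0.ne',
      zero_div, div_self hT0.ne', truncRate, integral_unitInterval_eq, smul_eq_mul]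
    ring

end Upper

/-! ### Steering the process: construction for the lower bound. -/

/-- With probability at least `p`, the `n`-th state is `z`, it is reached between the times `s` and
`s + n * η`, and all earlier states `w` satisfy `good t w` at the times `t` at which the process
is there. -/
def Reach {Ω : Type*} [MeasurableSpace Ω] (P : Measure Ω) (Z : ℕ → Ω → ℕ × ℕ) (τ : ℕ → Ω → ℝ)
    (good : ℝ → ℕ × ℕ → Prop) (η : ℝ) (n : ℕ) (z : ℕ × ℕ) (s p : ℝ) : Prop :=
  ∃ E, MeasurableSet[past Z τ n] E ∧ ENNReal.ofReal p ≤ P E ∧ ∀ ω ∈ E,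
    Z 0 ω = (0, 0) ∧ Z n ω = z ∧ s ≤ ∑ i ∈ Finset.range n, τ i ω ∧
    (0 < n → s < ∑ i ∈ Finset.range n, τ i ω) ∧ ∑ i ∈ Finset.range n, τ i ω ≤ s + n * η ∧
    (∀ i < n, 0 < τ i ω) ∧ ∀ i < n, ∀ t, ∑ k ∈ Finset.range i, τ k ω ≤ t →
      t < ∑ k ∈ Finset.range (i + 1), τ k ω → good t (Z i ω)

section Lower

variable {Ω : Type*} [MeasurableSpace Ω] {lam : ℤ × ℤ → ℝ} {P : Measure Ω}
  {Z : ℕ → Ω → ℕ × ℕ} {τ : ℕ → Ω → ℝ} {good : ℝ → ℕ × ℕ → Prop} {η : ℝ}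

lemma Reach.mono {n : ℕ} {z : ℕ × ℕ} {s p p' : ℝ} (h : Reach P Z τ good η n z s p) (hp : p' ≤ p) :
    Reach P Z τ good η n z s p' := by
  obtain ⟨E, hE, hpE, hE'⟩ := h
  exact ⟨E, hE, (ENNReal.ofReal_le_ofReal hp).trans hpE, hE'⟩

lemma HasJumpLaw.reach_zero (h : HasJumpLaw lam P Z τ) : Reach P Z τ good η 0 (0, 0) 0 1 := by
  refine ⟨{ω | Z 0 ω = (0, 0)}, ?_, ?_, ?_⟩
  · exact measurable_past_state le_rfl (measurableSet_singleton ((0, 0) : ℕ × ℕ))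
  · have := h.law 0 (fun _ => (0, 0)) 0 (fun _ => le_rfl)
    simp only [Nat.le_zero, forall_eq, not_lt_zero, IsEmpty.forall_iff, implies_true, and_true,
      Finset.range_zero, Finset.prod_empty, ENNReal.ofReal_one, if_true] at this
    rw [this, ENNReal.ofReal_one]
  · intro ω hω
    have hω' : Z 0 ω = (0, 0) := hω
    simp [hω']

/-- From `exp (-x) ≤ 1 / (1 + x)` the right side is at least `x / (1 + x)`. It bounds below the
chance that a jump falls in a short window. -/
lemma half_le_one_sub_exp_neg {x : ℝ} (h0 : 0 ≤ x) (h1 : x ≤ 1) : x / 2 ≤ 1 - Real.exp (-x) := by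
  have h2 := Real.add_one_le_exp x
  have h3 : Real.exp (-x) * Real.exp x = 1 := by rw [← Real.exp_add]; simp
  have h4 := Real.exp_pos (-x)
  nlinarith

variable [IsProbabilityMeasure P]

/-- The process can stay in a state for a given time and then jump to a given neighbour. -/
lemma HasJumpLaw.reach_succ (h : HasJumpLaw lam P Z τ) (hlam : ∀ y ∈ jumps, 0 < lam y)
    (hη : 0 ≤ η) {n : ℕ} {z w : ℕ × ℕ} {s p L l : ℝ} (hr : Reach P Z τ good η n z s p)
    (hp : 0 ≤ p) (hL : 0 ≤ L) (hl : l ≤ intensity lam z (displacement z w))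
    (hz : totalIntensity lam z * η ≤ 1)
    (hgood : ∀ t, s ≤ t → t ≤ s + L + (n + 1) * η → good t z) :
    Reach P Z τ good η (n + 1) w (s + L)
      (p * (Real.exp (-(totalIntensity lam z * L)) * (l * η / 2))) := by
  obtain ⟨E, hE, hpE, hE'⟩ := hr
  have hpos := totalIntensity_pos hlam z
  have hmk := h.markov hlam n z w (A := Set.Ioc L (L + η)) measurableSet_Ioc hE
  refine ⟨E ∩ {ω | Z n ω = z ∧ τ n ω ∈ Set.Ioc L (L + η) ∧ Z (n + 1) ω = w}, ?_, ?_, ?_⟩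
  · refine @MeasurableSet.inter _ (past Z τ (n + 1)) _ _ (past_mono (Nat.le_succ n) _ hE) ?_
    refine @MeasurableSet.inter _ (past Z τ (n + 1)) {ω | Z n ω = z}
      {ω | τ n ω ∈ Set.Ioc L (L + η) ∧ Z (n + 1) ω = w} ?_ ?_
    · exact measurable_past_state (Nat.le_succ n) (measurableSet_singleton z)
    refine @MeasurableSet.inter _ (past Z τ (n + 1)) {ω | τ n ω ∈ Set.Ioc L (L + η)}
      {ω | Z (n + 1) ω = w} ?_ ?_
    · exact measurable_past_time (Nat.lt_succ_self n) measurableSet_Ioc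
    · exact measurable_past_state le_rfl (measurableSet_singleton w)
  · have : E ∩ {ω | Z n ω = z} = E := Set.inter_eq_left.2 fun ω hω => (hE' ω hω).2.1
    rw [hmk, this, expMeasure_Ioc hpos hL hη, ENNReal.ofReal_mul hp]
    refine mul_le_mul' hpE ?_
    rw [← ENNReal.ofReal_mul (jumpProb_nonneg hlam _ _)]
    refine ENNReal.ofReal_le_ofReal ?_
    have h1 := half_le_one_sub_exp_neg (x := totalIntensity lam z * η) (by positivity) hz
    -- The `1 / h` in the jump probability cancels the `h` in the window probability, so the cost of
    -- a jump does not depend on the state.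
    have h2 : l * η / 2 ≤ jumpProb lam z (displacement z w) *
        (1 - Real.exp (-(totalIntensity lam z * η))) := by
      calc l * η / 2 ≤ intensity lam z (displacement z w) * η / 2 := by gcongr
        _ = jumpProb lam z (displacement z w) * (totalIntensity lam z * η / 2) := by
            unfold jumpProb; field_simp
        _ ≤ _ := mul_le_mul_of_nonneg_left h1 (jumpProb_nonneg hlam _ _)
    have := mul_le_mul_of_nonneg_left h2 (Real.exp_pos (-(totalIntensity lam z * L))).le
    linarith
  · rintro ω ⟨hω, hωz, hωτ, hωw⟩
    obtain ⟨h0, -, h1, -, h2, h3, h4⟩ := hE' ω hω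
    have hS : ∑ i ∈ Finset.range (n + 1), τ i ω = ∑ i ∈ Finset.range n, τ i ω + τ n ω :=
      Finset.sum_range_succ _ _
    have hup : ∑ i ∈ Finset.range (n + 1), τ i ω ≤ s + L + (n + 1) * η := by
      rw [hS]; linarith [hωτ.2]
    refine ⟨h0, hωw, ?_, fun _ => ?_, ?_, ?_, ?_⟩
    · rw [hS]; linarith [hωτ.1]
    · rw [hS]; linarith [hωτ.1]
    · push_cast; exact hup
    · intro i hi
      rcases Nat.lt_succ_iff_lt_or_eq.1 hi with hi | rfl
      · exact h3 i hi
      · linarith [hωτ.1]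
    · intro i hi t ht1 ht2
      rcases Nat.lt_succ_iff_lt_or_eq.1 hi with hi | rfl
      · exact h4 i hi t ht1 ht2
      · rw [hωz]
        exact hgood t (h1.trans ht1) (ht2.le.trans hup)

/-- The number of unit steps between two states. -/
def gridDist (z w : ℕ × ℕ) : ℕ := (z.1 - w.1) + (w.1 - z.1) + ((z.2 - w.2) + (w.2 - z.2))

/-- A neighbour of `z` that is closer to `w`, and is reached with an intensity bounded below. -/
lemma exists_step {l : ℝ} (hl : l ≤ lam (1, 0) ∧ l ≤ lam (0, 1) ∧ l ≤ lam (-1, 0) ∧ l ≤ lam (0, -1))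
    (hl0 : 0 ≤ l) (z w : ℕ × ℕ) (d : ℕ) (hd : gridDist z w = d + 1) :
    ∃ z', gridDist z' w = d ∧ l ≤ intensity lam z (displacement z z') ∧
      min z.1 w.1 ≤ z'.1 ∧ z'.1 ≤ max z.1 w.1 ∧ min z.2 w.2 ≤ z'.2 ∧ z'.2 ≤ max z.2 w.2 := by
  obtain ⟨h1, h2, h3, h4⟩ := hl
  obtain ⟨a, b⟩ := z
  obtain ⟨c, e⟩ := w
  simp only [gridDist] at hd
  have hmul : ∀ (k : ℕ) (x : ℝ), l ≤ x → l ≤ ((k + 1 : ℕ) : ℝ) * x := by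
    intro k x hx
    push_cast
    have : 0 ≤ (k : ℝ) * x := mul_nonneg (Nat.cast_nonneg k) (hl0.trans hx)
    linarith
  -- The first coordinate is corrected before the second, without diagonal jumps. A downward step
  -- starts at a positive coordinate, so its intensity is at least the constant.
  rcases lt_trichotomy a c with hac | hac | hac
  · refine ⟨(a + 1, b), by simp only [gridDist]; omega, ?_, ?_⟩
    · simpa [intensity, displacement] using h1
    · simp only; omega
  · rcases lt_trichotomy b e with hbe | hbe | hbe
    · refine ⟨(a, b + 1), by simp only [gridDist]; omega, ?_, ?_⟩
      · simpa [intensity, displacement] using h2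
      · simp only; omega
    · omega
    · obtain ⟨k, rfl⟩ : ∃ k, b = k + 1 := ⟨b - 1, by omega⟩
      refine ⟨(a, k), by simp only [gridDist]; omega, ?_, ?_⟩
      · have := hmul k _ h4
        simpa [intensity, displacement] using this
      · simp only; omega
  · obtain ⟨k, rfl⟩ : ∃ k, a = k + 1 := ⟨a - 1, by omega⟩
    refine ⟨(k, b), by simp only [gridDist]; omega, ?_, ?_⟩
    · have := hmul k _ h3
      simpa [intensity, displacement] using this
    · simp only; omega

/-- The process can move quickly along a shortest lattice path between two states. -/
lemma HasJumpLaw.reach_move (h : HasJumpLaw lam P Z τ) (hlam : ∀ y ∈ jumps, 0 < lam y)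
    {l : ℝ} (hl : l ≤ lam (1, 0) ∧ l ≤ lam (0, 1) ∧ l ≤ lam (-1, 0) ∧ l ≤ lam (0, -1))
    (hl0 : 0 ≤ l) (hη : 0 ≤ η) {w : ℕ × ℕ} {s κ : ℝ} {a₁ b₁ a₂ b₂ : ℕ}
    (hbox : ∀ z : ℕ × ℕ, a₁ ≤ z.1 → z.1 ≤ b₁ → a₂ ≤ z.2 → z.2 ≤ b₂ →
      totalIntensity lam z * η ≤ 1 ∧ ∀ t, s ≤ t → t ≤ s + κ → good t z)
    (hw : a₁ ≤ w.1 ∧ w.1 ≤ b₁ ∧ a₂ ≤ w.2 ∧ w.2 ≤ b₂) (d : ℕ) :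
    ∀ {n : ℕ} {z : ℕ × ℕ} {p : ℝ}, Reach P Z τ good η n z s p → 0 ≤ p → gridDist z w = d →
      a₁ ≤ z.1 ∧ z.1 ≤ b₁ ∧ a₂ ≤ z.2 ∧ z.2 ≤ b₂ → ((n + d : ℕ) : ℝ) * η ≤ κ →
      Reach P Z τ good η (n + d) w s (p * (l * η / 2) ^ d) := by
  induction d with
  | zero =>
    intro n z p hr hp hd hz hκ
    have : z = w := by
      simp only [gridDist] at hd
      exact Prod.ext (by omega) (by omega)
    subst this
    simpa using hr
  | succ d ih =>
    intro n z p hr hp hd hz hκ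
    obtain ⟨z', hd', hl', hz'⟩ := exists_step hl hl0 z w d hd
    obtain ⟨hb1, hb2⟩ := hbox z hz.1 hz.2.1 hz.2.2.1 hz.2.2.2
    have hκ' : ((n : ℝ) + 1) * η ≤ κ := by
      refine le_trans (mul_le_mul_of_nonneg_right ?_ hη) hκ
      push_cast
      have : (0 : ℝ) ≤ d := Nat.cast_nonneg d
      linarith
    -- No waiting: the jump falls in a window of length `η`, so the base time `s` stays put and only
    -- the delay `nη` grows.
    have h1 := h.reach_succ hlam hη (w := z') (L := 0) hr hp le_rfl hl' hb1
      (fun t ht1 ht2 => hb2 t ht1 (by linarith))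
    rw [add_zero, mul_zero, neg_zero, Real.exp_zero, one_mul] at h1
    have h2 := ih h1 (by positivity) hd' (by omega) (by
      rw [show n + 1 + d = n + (d + 1) by omega]; exact hκ)
    rw [show n + 1 + d = n + (d + 1) by omega] at h2
    convert h2 using 1
    ring

/-- The process can follow given levels, staying at each of them for the time `Δ`. -/
lemma HasJumpLaw.reach_levels (h : HasJumpLaw lam P Z τ) (hlam : ∀ y ∈ jumps, 0 < lam y)
    {l : ℝ} (hl : l ≤ lam (1, 0) ∧ l ≤ lam (0, 1) ∧ l ≤ lam (-1, 0) ∧ l ≤ lam (0, -1))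
    (hl0 : 0 ≤ l) (hη : 0 ≤ η) (hlη : l * η / 2 ≤ 1) {Δ κ : ℝ} (hΔ : 0 ≤ Δ) {K B : ℕ}
    (lev : ℕ → ℕ × ℕ) (hlev0 : lev 0 = (0, 0)) (hB : ∀ j, (lev j).1 < B ∧ (lev j).2 < B)
    (hBη : ∀ z : ℕ × ℕ, z.1 ≤ B → z.2 ≤ B → totalIntensity lam z * η ≤ 1)
    (hκ : ((K * (2 * B + 1) : ℕ) : ℝ) * η ≤ κ)
    (hmove : ∀ j < K, ∀ z : ℕ × ℕ, min (lev j).1 (lev (j + 1)).1 ≤ z.1 →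
      z.1 ≤ max (lev j).1 (lev (j + 1)).1 + 1 → min (lev j).2 (lev (j + 1)).2 ≤ z.2 →
      z.2 ≤ max (lev j).2 (lev (j + 1)).2 + 1 → ∀ t, j * Δ ≤ t → t ≤ j * Δ + κ → good t z)
    (hhold : ∀ j < K, ∀ t, j * Δ ≤ t → t ≤ (j + 1) * Δ + κ → good t (lev (j + 1))) (j : ℕ)
    (hj : j ≤ K) :
    ∃ n z, j ≤ n ∧ n ≤ j * (2 * B + 1) ∧ (lev j).1 ≤ z.1 ∧ z.1 ≤ (lev j).1 + 1 ∧ z.2 = (lev j).2 ∧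
      Reach P Z τ good η n z (j * Δ) ((l * η / 2) ^ (j * (2 * B + 1)) *
        Real.exp (-(Δ * ∑ i ∈ Finset.range j, totalIntensity lam (lev (i + 1))))) := by
  induction j with
  | zero =>
    refine ⟨0, (0, 0), le_rfl, by simp, by simp [hlev0], by simp [hlev0], by simp [hlev0], ?_⟩
    simpa using h.reach_zero
  | succ j ih =>
    obtain ⟨n, z, hn1, hn2, hz1, hz2, hz3, hr⟩ := ih (by omega)
    have hq0 : 0 ≤ l * η / 2 := by positivity
    have hB1 := hB j
    have hB2 := hB (j + 1)
    set d := gridDist z (lev (j + 1)) with hd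
    have hd2 : d ≤ 2 * B := by
      simp only [hd, gridDist]; omega
    have hnd : n + d + 1 ≤ (j + 1) * (2 * B + 1) := by
      have : (j + 1) * (2 * B + 1) = j * (2 * B + 1) + (2 * B + 1) := by ring
      omega
    have hnK : ((n + d + 1 : ℕ) : ℝ) * η ≤ κ := by
      refine le_trans (mul_le_mul_of_nonneg_right ?_ hη) hκ
      exact_mod_cast hnd.trans (Nat.mul_le_mul_right _ hj)
    have hmv := h.reach_move hlam hl hl0 hη (w := lev (j + 1)) (s := j * Δ) (κ := κ)
      (a₁ := min (lev j).1 (lev (j + 1)).1) (b₁ := max (lev j).1 (lev (j + 1)).1 + 1)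
      (a₂ := min (lev j).2 (lev (j + 1)).2) (b₂ := max (lev j).2 (lev (j + 1)).2 + 1)
      (fun z' h1 h2 h3 h4 => ⟨hBη z' (by omega) (by omega), hmove j (by omega) z' h1 h2 h3 h4⟩)
      (by omega) d hr (by positivity) rfl (by omega) (by
        refine le_trans (mul_le_mul_of_nonneg_right ?_ hη) hnK
        exact_mod_cast Nat.le_succ _)
    -- A hold must end with a jump; a unit jump to the right is possible from every state. This is
    -- the origin of the `+ 1` allowed in the first coordinate.
    have hst := h.reach_succ hlam hη (w := ((lev (j + 1)).1 + 1, (lev (j + 1)).2)) (L := Δ) (l := l)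
      hmv (by positivity) hΔ (by simpa [intensity, displacement] using hl.1)
      (hBη _ (by omega) (by omega)) (fun t ht1 ht2 => hhold j (by omega) t ht1 (by
        push_cast at hnK ht2
        linarith))
    refine ⟨n + d + 1, ((lev (j + 1)).1 + 1, (lev (j + 1)).2), by omega, hnd, by simp, by simp, rfl, ?_⟩
    have hs : (j : ℝ) * Δ + Δ = ((j + 1 : ℕ) : ℝ) * Δ := by push_cast; ring
    rw [hs] at hst
    refine hst.mono ?_
    rw [Finset.sum_range_succ, mul_add Δ, neg_add, Real.exp_add, mul_comm Δ (totalIntensity _ _)]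
    -- A move takes at most `2B` jumps and the end of the hold one more. Since the base is at most
    -- one, padding to this worst case only lowers the bound.
    have e : (l * η / 2) ^ ((j + 1) * (2 * B + 1)) ≤
        (l * η / 2) ^ (j * (2 * B + 1)) * (l * η / 2) ^ d * (l * η / 2) := by
      rw [← pow_add, ← pow_succ]
      exact pow_le_pow_of_le_one hq0 hlη (by
        have : (j + 1) * (2 * B + 1) = j * (2 * B + 1) + (2 * B + 1) := by ring
        omega)
    calc _ ≤ ((l * η / 2) ^ (j * (2 * B + 1)) * (l * η / 2) ^ d * (l * η / 2)) *
          (Real.exp (-(Δ * ∑ i ∈ Finset.range j, totalIntensity lam (lev (i + 1)))) *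
          Real.exp (-(totalIntensity lam (lev (j + 1)) * Δ))) :=
          mul_le_mul_of_nonneg_right e (by positivity)
      _ = _ := by ring

end Lower

/-! ### Step functions and the path space. -/

/-- Descending from `n` to the last crossing of `y` avoids any monotonicity of `S`. -/
lemma exists_mem_Ico_of_lt {S : ℕ → ℝ} {n : ℕ} {y : ℝ} (h0 : S 0 ≤ y) (hn : y < S n) :
    ∃ i < n, S i ≤ y ∧ y < S (i + 1) := by
  induction n with
  | zero => linarith
  | succ n ih =>
    rcases lt_or_ge y (S n) with h | h
    · obtain ⟨i, hi, h'⟩ := ih h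
      exact ⟨i, by omega, h'⟩
    · exact ⟨n, by omega, h, hn⟩

lemma exists_mem_Ioc_of_le {S : ℕ → ℝ} {n : ℕ} {y : ℝ} (h0 : S 0 < y) (hn : y ≤ S n) :
    ∃ i < n, S i < y ∧ y ≤ S (i + 1) := by
  induction n with
  | zero => linarith
  | succ n ih =>
    rcases le_or_gt y (S n) with h | h
    · obtain ⟨i, hi, h'⟩ := ih h
      exact ⟨i, by omega, h'⟩
    · exact ⟨n, by omega, h, hn⟩

/-- A step function with finitely many steps belongs to the path space. -/
lemma mem_pathSpace_of_step {x : unitInterval → ℝ × ℝ} {S : ℕ → ℝ} {n : ℕ} {T : ℝ} (hT : 0 < T)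
    (hS0 : S 0 = 0) (hSn : T < S n) (c : ℕ → ℝ × ℝ)
    (hx : ∀ i < n, ∀ t : unitInterval, S i ≤ t * T → t * T < S (i + 1) → x t = c i)
    (hc : ∀ i, 0 ≤ (c i).1 ∧ 0 ≤ (c i).2) (hc0 : c 0 = (0, 0)) (hS1 : 0 < n → 0 < S 1) :
    x ∈ pathSpace := by
  have hle : ∀ t : unitInterval, (t : ℝ) * T ≤ T := fun t =>
    mul_le_of_le_one_left hT.le t.2.2
  have hnn : ∀ t : unitInterval, 0 ≤ (t : ℝ) * T := fun t => mul_nonneg t.2.1 hT.le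
  have hex : ∀ t : unitInterval, ∃ i < n, S i ≤ t * T ∧ (t : ℝ) * T < S (i + 1) := fun t =>
    exists_mem_Ico_of_lt (by rw [hS0]; exact hnn t) ((hle t).trans_lt hSn)
  have hcont : Continuous fun t : unitInterval => (t : ℝ) * T := by fun_prop
  have hright : ∀ t, ContinuousWithinAt x (Set.Ici t) t := by
    intro t
    obtain ⟨i, hi, h1, h2⟩ := hex t
    have hev : ∀ᶠ u in 𝓝[≥] t, c i = x u := by
      filter_upwards [self_mem_nhdsWithin,
        mem_nhdsWithin_of_mem_nhds ((isOpen_Iio.preimage hcont).mem_nhds h2)] with u hu1 hu2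
      exact (hx i hi u (h1.trans (mul_le_mul_of_nonneg_right hu1 hT.le)) hu2).symm
    rw [ContinuousWithinAt, hx i hi t h1 h2]
    exact tendsto_const_nhds.congr' hev
  have hleft : ∀ (t : unitInterval) (i : ℕ), i < n → S i < t * T → (t : ℝ) * T ≤ S (i + 1) →
      ∀ᶠ u in 𝓝[<] t, c i = x u := by
    intro t i hi h1 h2
    filter_upwards [self_mem_nhdsWithin,
      mem_nhdsWithin_of_mem_nhds ((isOpen_Ioi.preimage hcont).mem_nhds h1)] with u hu1 hu2
    have hu1' : (u : ℝ) < t := hu1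
    exact (hx i hi u (le_of_lt hu2) ((mul_lt_mul_of_pos_right hu1' hT).trans_le h2)).symm
  refine ⟨fun t => ?_, hright, fun t => ?_, ?_, ?_⟩
  · obtain ⟨i, hi, h1, h2⟩ := hex t
    rw [hx i hi t h1 h2]
    exact hc i
  · rcases eq_or_lt_of_le (hnn t) with h | h
    · have ht : t = 0 := by
        rcases mul_eq_zero.1 h.symm with h | h
        · exact Subtype.ext h
        · exact absurd h hT.ne'
      -- At `t = 0` the left neighbourhood filter is trivial, so any value serves as the limit.
      refine ⟨0, ?_⟩
      have : (Set.Iio t) = ∅ := by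
        rw [ht]
        exact Set.eq_empty_of_forall_notMem fun u hu => not_lt.2 u.2.1 hu
      rw [this, nhdsWithin_empty]
      exact tendsto_bot
    · obtain ⟨i, hi, h1, h2⟩ := exists_mem_Ioc_of_le (hS0.trans_lt h) ((hle t).trans hSn.le)
      exact ⟨c i, tendsto_const_nhds.congr' (hleft t i hi h1 h2)⟩
  -- Discontinuities occur only where `t * T` is one of finitely many `S i`, and `t ↦ t * T` is
  -- injective.
  · refine Set.Finite.subset (Set.Finite.preimage (f := fun t : unitInterval => (t : ℝ) * T) ?_
      ((Set.finite_Iio n).image S)) fun t ht => ?_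
    · intro t _ u _ htu
      exact Subtype.ext (mul_right_cancel₀ hT.ne' htu)
    · by_contra hne
      refine ht ?_
      obtain ⟨i, hi, h1, h2⟩ := hex t
      have h1' : S i < t * T := lt_of_le_of_ne h1 fun he => hne ⟨i, hi, he⟩
      have hev : ∀ᶠ u in 𝓝 t, c i = x u := by
        filter_upwards [(isOpen_Iio.preimage hcont).mem_nhds h2,
          (isOpen_Ioi.preimage hcont).mem_nhds h1'] with u hu1 hu2
        exact (hx i hi u (le_of_lt hu2) hu1).symm
      rw [ContinuousAt, hx i hi t h1 h2]
      exact tendsto_const_nhds.congr' hev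
  · have hn : 0 < n := by
      rcases Nat.eq_zero_or_pos n with rfl | h
      · linarith
      · exact h
    rw [hx 0 hn 0 (by simp [hS0]) (by simpa using hS1 hn), hc0]

/-- At time `t` the state `z` is allowed by the strip at the scale `T`. -/
def InStrip (f : unitInterval → ℝ × ℝ) (ε M T t : ℝ) (z : ℕ × ℕ) : Prop :=
  ∀ u : unitInterval, (u : ℝ) * T = t →
    ((f u).1 - ε ≤ z.1 / T ∧ (z.1 : ℝ) / T ≤ M) ∧ ((f u).2 - ε ≤ z.2 / T ∧ (z.2 : ℝ) / T ≤ M)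

/-- As `0 < n`, the `n`-th jump comes strictly after `T`, so the states before index `n` determine
the scaled path on all of `[0, 1]`, endpoint included. -/
lemma Reach.le_measure_stripEps {Ω : Type*} [MeasurableSpace Ω] {P : Measure Ω}
    {Z : ℕ → Ω → ℕ × ℕ} {τ : ℕ → Ω → ℝ} {ξ : ℝ≥0 → Ω → ℕ × ℕ}
    (hξ : ∀ᵐ ω ∂P, ∀ (n : ℕ) (t : ℝ≥0), ∑ i ∈ Finset.range n, τ i ω ≤ (t : ℝ) →
      (t : ℝ) < ∑ i ∈ Finset.range (n + 1), τ i ω → ξ t ω = Z n ω)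
    {f : unitInterval → ℝ × ℝ} {ε M T η p : ℝ} (hT : 0 < T) {n : ℕ} (hn : 0 < n) {z : ℕ × ℕ}
    (h : Reach P Z τ (InStrip f ε M T) η n z T p) :
    ENNReal.ofReal p ≤ P {ω | scaledPath ξ T ω ∈ stripEps f ε M} := by
  obtain ⟨E, -, hpE, hE⟩ := h
  refine hpE.trans (measure_mono_ae ?_)
  filter_upwards [hξ] with ω hω hmem
  obtain ⟨h0, -, -, hS, -, hpos, hgood⟩ := hE ω hmem
  set S : ℕ → ℝ := fun n => ∑ i ∈ Finset.range n, τ i ω with hSdef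
  have hS0 : S 0 = 0 := by simp [hSdef]
  have hx : ∀ i, ∀ t : unitInterval, S i ≤ t * T → t * T < S (i + 1) →
      scaledPath ξ T ω t = (((Z i ω).1 : ℝ) / T, ((Z i ω).2 : ℝ) / T) := by
    intro i t h1 h2
    have hnn : 0 ≤ (t : ℝ) * T := mul_nonneg t.2.1 hT.le
    have : ξ (Real.toNNReal (t * T)) ω = Z i ω := by
      refine hω i _ ?_ ?_ <;> rwa [Real.coe_toNNReal _ hnn]
    simp only [scaledPath, this]
  refine ⟨mem_pathSpace_of_step hT hS0 (hS hn) _ (fun i _ => hx i)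
    (fun i => ⟨by positivity, by positivity⟩) (by simp [h0])
    (fun _ => by simpa [hSdef] using hpos 0 hn), fun t => ?_⟩
  obtain ⟨i, hi, h1, h2⟩ := exists_mem_Ico_of_lt (S := S) (n := n) (y := t * T)
    (by rw [hS0]; exact mul_nonneg t.2.1 hT.le)
    ((mul_le_of_le_one_left hT.le t.2.2).trans_lt (hS hn))
  rw [hx i t h1 h2]
  exact hgood i hi _ h1 h2 t rfl

/-! ### Discretisation of the lower edge and the lower bound for the strip. -/

lemma cost_one (lam : ℤ × ℤ → ℝ) : cost lam 1 1 = lam (-1, 0) + lam (0, -1) + lam (-1, -1) := by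
  simp [cost]

lemma cost_one_nonneg {lam : ℤ × ℤ → ℝ} (hlam : ∀ y ∈ jumps, 0 < lam y) : 0 ≤ cost lam 1 1 := by
  obtain ⟨-, -, h3, h4, h5⟩ := lam_pos hlam
  rw [cost_one]
  positivity

lemma truncCost_le_add {lam : ℤ × ℤ → ℝ} (hlam : ∀ y ∈ jumps, 0 < lam y) {f : unitInterval → ℝ × ℝ}
    {ε δ : ℝ} (hδ : 0 ≤ δ) {u v : unitInterval} (h1 : (f u).1 ≤ (f v).1 + δ)
    (h2 : (f u).2 ≤ (f v).2 + δ) :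
    truncCost lam f ε u ≤ truncCost lam f ε v + cost lam 1 1 * δ := by
  rw [cost_one, truncCost, truncCost, ← cost_add]
  refine cost_mono hlam ?_ ?_
  · exact max_le (by linarith [le_max_left ((f v).1 - ε) 0]) (by positivity)
  · exact max_le (by linarith [le_max_left ((f v).2 - ε) 0]) (by positivity)

/-- The `j`-th point of the grid of mesh `1 / K`. -/
noncomputable def gridPoint (K j : ℕ) : unitInterval := Set.projIcc 0 1 zero_le_one ((j : ℝ) / K)

lemma coe_gridPoint {K j : ℕ} (hK : 0 < K) (hj : j ≤ K) : (gridPoint K j : ℝ) = j / K := by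
  have hK' : (0 : ℝ) < K := by exact_mod_cast hK
  have : (j : ℝ) ≤ K := by exact_mod_cast hj
  rw [gridPoint, Set.projIcc_of_mem zero_le_one
    ⟨by positivity, div_le_one_of_le₀ this hK'.le⟩]

/-- A lower Riemann sum bound. -/
lemma sum_truncCost_le {lam : ℤ × ℤ → ℝ} (hlam : ∀ y ∈ jumps, 0 < lam y)
    {f : unitInterval → ℝ × ℝ} (hf : Continuous f) {ε δ : ℝ} (hδ : 0 ≤ δ) {K : ℕ} (hK : 0 < K)
    (hunif : ∀ u v : unitInterval, |(u : ℝ) - v| ≤ 2 / K →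
      (f u).1 ≤ (f v).1 + δ ∧ (f u).2 ≤ (f v).2 + δ) :
    (∑ j ∈ Finset.range K, truncCost lam f ε (gridPoint K j)) / K ≤
      truncRate lam f ε + cost lam 1 1 * δ := by
  have hK' : (0 : ℝ) < K := by exact_mod_cast hK
  set G := Set.IccExtend (zero_le_one' ℝ) (truncCost lam f ε) with hG
  have hGc : Continuous G := (continuous_truncCost lam hf ε).Icc_extend'
  have hS : Monotone fun j : ℕ => (j : ℝ) / K := fun i j hij => by
    have : (i : ℝ) ≤ j := by exact_mod_cast hij
    simp only
    gcongr
  -- Applied to `-G` to bound the integral from below; the last piece is empty because the grid ends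
  -- at `1`.
  have key := integral_le_sum_mul_sub (g := fun s => -G s) (T := 1) (m := K) hGc.neg hS
    (a := fun j => -truncCost lam f ε (gridPoint K j) + cost lam 1 1 * δ)
    (by simp [div_self hK'.ne'])
    (fun j hj s h1 h2 => by
      have hs : s ∈ Set.Icc (0 : ℝ) 1 := by
        refine ⟨le_trans (by positivity) h1.le, h2.le.trans ?_⟩
        rw [div_le_one hK']
        exact_mod_cast hj
      have hle := truncCost_le_add hlam (ε := ε) hδ (u := gridPoint K j) (v := ⟨s, hs⟩) (hunif _ _ (by
        rw [coe_gridPoint hK hj.le, abs_le]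
        push_cast at h2
        have e : ((j : ℝ) + 1) / K = j / K + 1 / K := by ring
        have e2 : (2 : ℝ) / K = 1 / K + 1 / K := by ring
        have : 0 < (1 : ℝ) / K := by positivity
        rw [e] at h2
        rw [e2]
        constructor <;> linarith)).1 (hunif _ _ (by
        rw [coe_gridPoint hK hj.le, abs_le]
        push_cast at h2
        have e : ((j : ℝ) + 1) / K = j / K + 1 / K := by ring
        have e2 : (2 : ℝ) / K = 1 / K + 1 / K := by ring
        have : 0 < (1 : ℝ) / K := by positivity
        rw [e] at h2
        rw [e2]
        constructor <;> linarith)).2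
      rw [hG, Set.IccExtend_of_mem _ _ hs]
      linarith)
    (fun s h1 h2 => by
      rw [div_self hK'.ne'] at h1
      linarith)
  have e : ∀ j : ℕ, ((j + 1 : ℕ) : ℝ) / K - (j : ℝ) / K = 1 / K := fun j => by push_cast; ring
  simp only [e, div_self hK'.ne', sub_self, mul_zero, add_zero, Nat.cast_zero, zero_div] at key
  rw [intervalIntegral.integral_neg, ← Finset.sum_mul, Finset.sum_add_distrib,
    Finset.sum_neg_distrib, Finset.sum_const, Finset.card_range, nsmul_eq_mul] at key
  have e3 : (-∑ j ∈ Finset.range K, truncCost lam f ε (gridPoint K j) + K * (cost lam 1 1 * δ)) *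
      (1 / K) = -((∑ j ∈ Finset.range K, truncCost lam f ε (gridPoint K j)) / K) +
        cost lam 1 1 * δ := by
    field_simp
  rw [e3] at key
  rw [truncRate, integral_unitInterval_eq]
  linarith

/-- The level at which the process is held during the `j`-th time interval. -/
noncomputable def level (f : unitInterval → ℝ × ℝ) (ε δ T : ℝ) (K : ℕ) : ℕ → ℕ × ℕ
  | 0 => (0, 0)
  | j + 1 => (⌈T * (max ((f (gridPoint K j)).1 - ε) 0 + δ)⌉₊,
      ⌈T * (max ((f (gridPoint K j)).2 - ε) 0 + δ)⌉₊)

section Level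

variable {f : unitInterval → ℝ × ℝ} {ε δ T M : ℝ} {K : ℕ}

/-- Of the two lattice units in `2 / T`, one pays for rounding up and the other leaves room for a
state one unit above the level. -/
lemma level_upper (hT : 1 ≤ T) (hδ : 0 ≤ δ) (hε : δ + 2 / T ≤ ε) (hM : δ + 2 / T ≤ M)
    (hfM : ∀ t, (f t).1 ≤ M ∧ (f t).2 ≤ M) (j : ℕ) :
    ((level f ε δ T K j).1 : ℝ) + 1 ≤ T * M ∧ ((level f ε δ T K j).2 : ℝ) + 1 ≤ T * M := by
  have hT0 : 0 < T := by linarith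
  have h2 : T * (δ + 2 / T) = T * δ + 2 := by field_simp
  have hTM : T * δ + 2 ≤ T * M := h2 ▸ mul_le_mul_of_nonneg_left hM hT0.le
  have hTδ : 0 ≤ T * δ := by positivity
  have key : ∀ x ≤ M, ((⌈T * (max (x - ε) 0 + δ)⌉₊ : ℕ) : ℝ) + 1 ≤ T * M := by
    intro x hx
    have h3 := (Nat.ceil_lt_add_one (show 0 ≤ T * (max (x - ε) 0 + δ) by positivity)).le
    have h4 : T * (max (x - ε) 0 + δ) + 2 ≤ T * M := by
      rcases le_total (x - ε) 0 with h | h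
      · rw [max_eq_right h]; linarith
      · rw [max_eq_left h]
        have : T * (x - ε + (δ + 2 / T)) ≤ T * M := mul_le_mul_of_nonneg_left (by linarith) hT0.le
        rw [mul_add, h2] at this
        linarith
    linarith
  rcases j with _ | j
  · simp only [level, Nat.cast_zero]
    constructor <;> linarith
  · exact ⟨key _ (hfM _).1, key _ (hfM _).2⟩

/-- For `j > 0` the level comes from `f` at `(j - 1) / K`, within `2 / K` of `u`, and its raise by
`δ` absorbs the oscillation. For `j = 0`, `f` is still at most `δ ≤ ε`. The window has two cells,
one for the hold and one for the delay. -/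
lemma level_lower (hT : 0 < T) (hδε : δ ≤ ε) (hK : 0 < K) (hf0 : f 0 = (0, 0))
    (hunif : ∀ u v : unitInterval, |(u : ℝ) - v| ≤ 2 / K →
      (f u).1 ≤ (f v).1 + δ ∧ (f u).2 ≤ (f v).2 + δ) {j : ℕ} (hj : j ≤ K) {u : unitInterval}
    (h1 : ((j : ℝ) - 1) / K ≤ u) (h2 : (u : ℝ) ≤ (j + 1) / K) :
    (f u).1 - ε ≤ (level f ε δ T K j).1 / T ∧ (f u).2 - ε ≤ (level f ε δ T K j).2 / T := by
  have hK' : (0 : ℝ) < K := by exact_mod_cast hK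
  rcases j with _ | j
  · have := hunif u 0 (by
      have h0 := u.2.1
      push_cast at h2
      rw [Set.Icc.coe_zero, sub_zero, abs_of_nonneg h0]
      refine h2.trans ?_
      gcongr
      norm_num)
    rw [hf0] at this
    simp only [level, Nat.cast_zero, zero_div]
    constructor
    · linarith [this.1]
    · linarith [this.2]
  · have := hunif u (gridPoint K j) (by
      rw [coe_gridPoint hK (by omega), abs_le]
      push_cast at h1 h2
      have e : ((j : ℝ) + 1 + 1) / K = j / K + 2 / K := by ring
      have e' : ((j : ℝ) + 1 - 1) / K = j / K := by ring
      rw [e] at h2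
      rw [e'] at h1
      have : 0 < 2 / (K : ℝ) := by positivity
      constructor <;> linarith)
    have key : ∀ x y, x ≤ y + δ → x - ε ≤ ((⌈T * (max (y - ε) 0 + δ)⌉₊ : ℕ) : ℝ) / T := by
      intro x y hxy
      rw [le_div_iff₀ hT]
      refine le_trans ?_ (Nat.le_ceil _)
      rw [mul_comm]
      exact mul_le_mul_of_nonneg_left (by linarith [le_max_left (y - ε) 0]) hT.le
    exact ⟨key _ _ this.1, key _ _ this.2⟩

/-- Rounding raises the scaled level by at most `1 / T`, which adds only the bounded term `cost lam
1 1` to the intensity. -/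
lemma totalIntensity_level_le {lam : ℤ × ℤ → ℝ} (hlam : ∀ y ∈ jumps, 0 < lam y) (hT : 0 < T)
    (hδ : 0 ≤ δ) (j : ℕ) :
    totalIntensity lam (level f ε δ T K (j + 1)) ≤ lam (1, 0) + lam (0, 1) +
      (T * (truncCost lam f ε (gridPoint K j) + cost lam 1 1 * δ) + cost lam 1 1) := by
  rw [totalIntensity_eq_add, downIntensity_div lam _ hT]
  have key : ∀ y : ℝ, ((⌈T * (max (y - ε) 0 + δ)⌉₊ : ℕ) : ℝ) / T ≤ max (y - ε) 0 + (δ + 1 / T) := by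
    intro y
    rw [div_le_iff₀ hT]
    have := (Nat.ceil_lt_add_one (show 0 ≤ T * (max (y - ε) 0 + δ) by positivity)).le
    refine this.trans (le_of_eq ?_)
    field_simp
    ring
  have h := cost_mono hlam (key (f (gridPoint K j)).1) (key (f (gridPoint K j)).2)
  rw [cost_add, ← cost_one] at h
  have h2 := mul_le_mul_of_nonneg_left h hT.le
  have e : T * (truncCost lam f ε (gridPoint K j) + cost lam 1 1 * δ) + cost lam 1 1 =
    T * (cost lam (max ((f (gridPoint K j)).1 - ε) 0) (max ((f (gridPoint K j)).2 - ε) 0) +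
      cost lam 1 1 * (δ + 1 / T)) := by
    unfold truncCost
    field_simp
    ring
  rw [e]
  simp only [level]
  linarith

end Level

section Lower

variable {Ω : Type*} [MeasurableSpace Ω] {lam : ℤ × ℤ → ℝ} {P : Measure Ω}
  {Z : ℕ → Ω → ℕ × ℕ} {τ : ℕ → Ω → ℝ} [IsProbabilityMeasure P] {ξ : ℝ≥0 → Ω → ℕ × ℕ}

/-- The lower bound for the probability that the scaled path stays in a strip, at a fixed scale. -/
lemma HasJumpLaw.le_measure_stripEps (h : HasJumpLaw lam P Z τ) (hlam : ∀ y ∈ jumps, 0 < lam y)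
    (hξ : ∀ᵐ ω ∂P, ∀ (n : ℕ) (t : ℝ≥0), ∑ i ∈ Finset.range n, τ i ω ≤ (t : ℝ) →
      (t : ℝ) < ∑ i ∈ Finset.range (n + 1), τ i ω → ξ t ω = Z n ω)
    {f : unitInterval → ℝ × ℝ} (hf : Continuous f) (hf0 : f 0 = (0, 0)) {ε δ M T : ℝ} {K : ℕ}
    (hfM : ∀ t, (f t).1 ≤ M ∧ (f t).2 ≤ M) (hT : 1 ≤ T) (hδ : 0 ≤ δ) (hε : δ + 2 / T ≤ ε)
    (hM : δ + 2 / T ≤ M) (hK : 0 < K)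
    (hunif : ∀ u v : unitInterval, |(u : ℝ) - v| ≤ 2 / K →
      (f u).1 ≤ (f v).1 + δ ∧ (f u).2 ≤ (f v).2 + δ) {l : ℝ}
    (hl : l ≤ lam (1, 0) ∧ l ≤ lam (0, 1) ∧ l ≤ lam (-1, 0) ∧ l ≤ lam (0, -1))
    (hl0 : 0 ≤ l) (hlT : l ≤ T ^ 2)
    (hBT : lam (1, 0) + lam (0, 1) + cost lam 1 1 * (T * M + 1) ≤ T ^ 2)
    (hKT : (K : ℝ) * (2 * (T * M + 1) + 1) / T ^ 2 ≤ T / K) :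
    ENNReal.ofReal ((l * (1 / T ^ 2) / 2) ^ (K * (2 * (⌊T * M⌋₊ + 1) + 1)) *
      Real.exp (-((lam (1, 0) + lam (0, 1) + cost lam 1 1) * T +
        T ^ 2 * (truncRate lam f ε + 2 * cost lam 1 1 * δ)))) ≤
      P {ω | scaledPath ξ T ω ∈ stripEps f ε M} := by
  obtain ⟨hl1, hl2, hl3, hl4, hl5⟩ := lam_pos hlam
  have hT0 : 0 < T := by linarith
  have hK' : (0 : ℝ) < K := by exact_mod_cast hK
  have h2T : 0 < 2 / T := by positivity
  have hM0 : 0 < M := by linarith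
  have hc0 := cost_one_nonneg hlam
  set B := ⌊T * M⌋₊ + 1 with hBdef
  have hBle : (B : ℝ) ≤ T * M + 1 := by
    rw [hBdef]
    push_cast
    linarith [Nat.floor_le (show 0 ≤ T * M by positivity)]
  have hup := level_upper (f := f) (K := K) hT hδ hε hM hfM
  have hB : ∀ j, (level f ε δ T K j).1 < B ∧ (level f ε δ T K j).2 < B := by
    intro j
    obtain ⟨h1, h2⟩ := hup j
    constructor
    · exact Nat.lt_succ_of_le (Nat.le_floor (by linarith))
    · exact Nat.lt_succ_of_le (Nat.le_floor (by linarith))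
  have hlow := fun (j : ℕ) (hj : j ≤ K) (u : unitInterval) =>
    level_lower (f := f) (ε := ε) (T := T) hT0 (by linarith) hK hf0 hunif hj (u := u)
  have hη0 : 0 ≤ 1 / T ^ 2 := by positivity
  have hBη : ∀ z : ℕ × ℕ, z.1 ≤ B → z.2 ≤ B → totalIntensity lam z * (1 / T ^ 2) ≤ 1 := by
    intro z hz1 hz2
    rw [mul_one_div, div_le_one (by positivity)]
    refine le_trans ?_ hBT
    have hz1' : (z.1 : ℝ) ≤ T * M + 1 := le_trans (by exact_mod_cast hz1) hBle
    have hz2' : (z.2 : ℝ) ≤ T * M + 1 := le_trans (by exact_mod_cast hz2) hBle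
    rw [totalIntensity_eq_add, downIntensity_div lam z one_pos, one_mul, div_one, div_one]
    have h1 := cost_mono hlam hz1' hz2'
    have h2 : cost lam (T * M + 1) (T * M + 1) = cost lam 1 1 * (T * M + 1) := by
      unfold cost; simp only [min_self]; ring
    linarith
  have hlη : l * (1 / T ^ 2) / 2 ≤ 1 := by
    have : l * (1 / T ^ 2) ≤ 1 := by
      rw [mul_one_div, div_le_one (by positivity)]; exact hlT
    linarith
  have hκ : ((K * (2 * B + 1) : ℕ) : ℝ) * (1 / T ^ 2) ≤ T / K := by
    refine le_trans ?_ hKT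
    rw [mul_one_div]
    push_cast
    gcongr
  -- With windows `η = 1 / T²` and `O(T)` jumps the total delay is `O(1 / T)`, well within one cell
  -- `κ = T / K`.
  obtain ⟨n, z, hn1, -, -, -, -, hr⟩ := h.reach_levels hlam (good := InStrip f ε M T) hl hl0 hη0 hlη
    (Δ := T / K) (κ := T / K) (by positivity) (level f ε δ T K) rfl hB hBη hκ
    (by
      intro j hj z hz1 hz2 hz3 hz4 t ht1 ht2 u hu
      have hu1 : (j : ℝ) / K ≤ u := by
        rw [div_le_iff₀ hK']
        rw [← hu] at ht1
        have : (j : ℝ) * T ≤ u * K * T := by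
          have := mul_le_mul_of_nonneg_right ht1 hK'.le
          have e : (j : ℝ) * (T / K) * K = j * T := by field_simp
          linarith
        exact le_of_mul_le_mul_right this hT0
      have hu2 : (u : ℝ) ≤ (j + 1) / K := by
        rw [le_div_iff₀ hK']
        rw [← hu] at ht2
        have : (u : ℝ) * K * T ≤ (j + 1) * T := by
          have := mul_le_mul_of_nonneg_right ht2 hK'.le
          have e : ((j : ℝ) * (T / K) + T / K) * K = (j + 1) * T := by field_simp
          linarith
        exact le_of_mul_le_mul_right this hT0
      have hinv : (0 : ℝ) < 1 / K := by positivity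
      obtain ⟨a1, a2⟩ := hlow j hj.le u (le_trans (by gcongr; linarith) hu1) hu2
      obtain ⟨b1, b2⟩ := hlow (j + 1) hj u (by push_cast; simpa using hu1)
        (hu2.trans (by push_cast; gcongr; linarith))
      have low : ∀ (x : ℝ) (a b c : ℕ), x ≤ a / T → x ≤ b / T → min a b ≤ c → x ≤ c / T := by
        intro x a b c ha hb hc
        rcases min_le_iff.1 hc with h | h
        · exact ha.trans (by have : (a : ℝ) ≤ c := by exact_mod_cast h
                             gcongr)
        · exact hb.trans (by have : (b : ℝ) ≤ c := by exact_mod_cast h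
                             gcongr)
      have upp : ∀ (a b c : ℕ), (a : ℝ) + 1 ≤ T * M → (b : ℝ) + 1 ≤ T * M → c ≤ max a b + 1 →
          (c : ℝ) / T ≤ M := by
        intro a b c ha hb hc
        rw [div_le_iff₀ hT0, mul_comm]
        have hc' : (c : ℝ) ≤ ((max a b + 1 : ℕ) : ℝ) := by exact_mod_cast hc
        rcases max_choice a b with h | h <;> rw [h] at hc' <;> push_cast at hc' <;> linarith
      exact ⟨⟨low _ _ _ _ a1 b1 hz1, upp _ _ _ (hup j).1 (hup (j + 1)).1 hz2⟩,
        ⟨low _ _ _ _ a2 b2 hz3, upp _ _ _ (hup j).2 (hup (j + 1)).2 hz4⟩⟩)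
    (by
      intro j hj t ht1 ht2 u hu
      have hu1 : (j : ℝ) / K ≤ u := by
        rw [div_le_iff₀ hK']
        rw [← hu] at ht1
        have : (j : ℝ) * T ≤ u * K * T := by
          have := mul_le_mul_of_nonneg_right ht1 hK'.le
          have e : (j : ℝ) * (T / K) * K = j * T := by field_simp
          linarith
        exact le_of_mul_le_mul_right this hT0
      have hu2 : (u : ℝ) ≤ (j + 1 + 1) / K := by
        rw [le_div_iff₀ hK']
        rw [← hu] at ht2
        have : (u : ℝ) * K * T ≤ (j + 1 + 1) * T := by
          have := mul_le_mul_of_nonneg_right ht2 hK'.le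
          have e : (((j : ℝ) + 1) * (T / K) + T / K) * K = (j + 1 + 1) * T := by field_simp
          linarith
        exact le_of_mul_le_mul_right this hT0
      obtain ⟨b1, b2⟩ := hlow (j + 1) hj u (by push_cast; simpa using hu1) (by push_cast; exact hu2)
      obtain ⟨c1, c2⟩ := hup (j + 1)
      refine ⟨⟨b1, ?_⟩, ⟨b2, ?_⟩⟩
      · rw [div_le_iff₀ hT0, mul_comm]; linarith
      · rw [div_le_iff₀ hT0, mul_comm]; linarith) K le_rfl
  rw [mul_div_cancel₀ T hK'.ne'] at hr
  refine (hr.mono ?_).le_measure_stripEps hξ hT0 (by omega)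
  refine mul_le_mul_of_nonneg_left (Real.exp_le_exp.2 (neg_le_neg ?_)) (by positivity)
  have hsum : ∑ i ∈ Finset.range K, totalIntensity lam (level f ε δ T K (i + 1)) ≤
      ∑ i ∈ Finset.range K, (lam (1, 0) + lam (0, 1) +
      (T * (truncCost lam f ε (gridPoint K i) + cost lam 1 1 * δ) + cost lam 1 1)) :=
    Finset.sum_le_sum fun i _ => totalIntensity_level_le hlam hT0 hδ i
  have hsum2 : ∑ i ∈ Finset.range K, (lam (1, 0) + lam (0, 1) +
      (T * (truncCost lam f ε (gridPoint K i) + cost lam 1 1 * δ) + cost lam 1 1)) =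
      K * (lam (1, 0) + lam (0, 1) + cost lam 1 1 + T * (cost lam 1 1 * δ)) +
        T * ∑ i ∈ Finset.range K, truncCost lam f ε (gridPoint K i) := by
    rw [Finset.mul_sum, ← nsmul_eq_mul, ← Finset.card_range K, ← Finset.sum_const, Finset.card_range,
      ← Finset.sum_add_distrib]
    exact Finset.sum_congr rfl fun i _ => by ring
  -- Of the error `2 * cost lam 1 1 * δ`, one half comes from this Riemann sum and the other from
  -- raising the levels.
  have hr2 := mul_le_mul_of_nonneg_left (sum_truncCost_le hlam hf (ε := ε) hδ hK hunif)
    (show 0 ≤ T ^ 2 by positivity)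
  calc T / K * ∑ i ∈ Finset.range K, totalIntensity lam (level f ε δ T K (i + 1))
      ≤ T / K * (K * (lam (1, 0) + lam (0, 1) + cost lam 1 1 + T * (cost lam 1 1 * δ)) +
        T * ∑ i ∈ Finset.range K, truncCost lam f ε (gridPoint K i)) := by
        rw [← hsum2]
        exact mul_le_mul_of_nonneg_left hsum (by positivity)
    _ = (lam (1, 0) + lam (0, 1) + cost lam 1 1) * T + T ^ 2 * (cost lam 1 1 * δ) +
        T ^ 2 * ((∑ i ∈ Finset.range K, truncCost lam f ε (gridPoint K i)) / K) := by
        field_simp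
    _ ≤ _ := by linarith

end Lower

/-! ### Logarithmic asymptotics and the limit in `ε`. -/

lemma coe_le_mul_log {p : ℝ≥0∞} {a c : ℝ} (hc : 0 ≤ c) (h : ENNReal.ofReal (Real.exp a) ≤ p) :
    ((c * a : ℝ) : EReal) ≤ (c : EReal) * ENNReal.log p := by
  have h1 := ENNReal.log_monotone h
  rw [ENNReal.log_ofReal_of_pos (Real.exp_pos a), Real.log_exp] at h1
  rw [EReal.coe_mul]
  exact mul_le_mul_of_nonneg_left h1 (by exact_mod_cast hc)

lemma mul_log_le_coe {p : ℝ≥0∞} {a c : ℝ} (hc : 0 ≤ c) (h : p ≤ ENNReal.ofReal (Real.exp a)) :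
    (c : EReal) * ENNReal.log p ≤ ((c * a : ℝ) : EReal) := by
  have h1 := ENNReal.log_monotone h
  rw [ENNReal.log_ofReal_of_pos (Real.exp_pos a), Real.log_exp] at h1
  rw [EReal.coe_mul]
  exact mul_le_mul_of_nonneg_left h1 (by exact_mod_cast hc)

lemma tendsto_log_div_self : Tendsto (fun T : ℝ => Real.log T / T) atTop (𝓝 0) :=
  Real.isLittleO_log_id_atTop.tendsto_div_nhds_zero

lemma tendsto_upper_exponent (J A B : ℝ) :
    Tendsto (fun T : ℝ => 1 / T ^ 2 * (Real.log (2 * T ^ 2) + (-(T ^ 2 * J) + A * √T * T + B))) atTop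
      (𝓝 (-J)) := by
  have hinv := tendsto_inv_atTop_zero (𝕜 := ℝ)
  have hsqrt : Tendsto (fun T : ℝ => (√T)⁻¹) atTop (𝓝 0) :=
    tendsto_inv_atTop_zero.comp Real.tendsto_sqrt_atTop
  have h := ((((hinv.mul hinv).const_mul (Real.log 2 + B)).add
    ((tendsto_log_div_self.mul hinv).const_mul 2)).add (hsqrt.const_mul A)).sub_const J
  simp only [mul_zero, add_zero, zero_sub] at h
  refine h.congr' ?_
  filter_upwards [eventually_gt_atTop 0] with T hT
  rw [Real.log_mul two_ne_zero (by positivity), Real.log_pow]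
  have hs : 0 < √T := Real.sqrt_pos.2 hT
  have hsq : √T * √T = T := Real.mul_self_sqrt hT.le
  have e : √T * T / T ^ 2 = (√T)⁻¹ := by
    rw [div_eq_iff (by positivity), ← div_eq_inv_mul, eq_div_iff hs.ne']
    nlinarith
  have : 1 / T ^ 2 * (Real.log 2 + ((2 : ℕ) : ℝ) * Real.log T + (-(T ^ 2 * J) + A * √T * T + B)) =
      (Real.log 2 + B) / T ^ 2 + 2 * Real.log T / T ^ 2 + A * (√T * T / T ^ 2) - J := by
    field_simp
    push_cast
    ring
  rw [this, e]
  field_simp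

/-- `O(T)` jumps at a price of order `log T` each are negligible against `T²`. -/
lemma tendsto_lower_exponent (J C M l K : ℝ) :
    Tendsto (fun T : ℝ => 1 / T ^ 2 * (K * (2 * (T * M + 1) + 1) * (Real.log (l / 2) - 2 * Real.log T)
      - (C * T + T ^ 2 * J))) atTop (𝓝 (-J)) := by
  have hinv := tendsto_inv_atTop_zero (𝕜 := ℝ)
  have h := ((((hinv.const_mul 3).const_add (2 * M)).const_mul K).mul
    ((hinv.const_mul (Real.log (l / 2))).sub (tendsto_log_div_self.const_mul 2))).sub
    ((hinv.const_mul C).add_const J)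
  simp only [mul_zero, add_zero, sub_zero, zero_add, zero_sub] at h
  refine h.congr' ?_
  filter_upwards [eventually_gt_atTop 0] with T hT
  field_simp
  ring

section Bounds

variable {f : unitInterval → ℝ × ℝ}

lemma exists_grid (hf : Continuous f) {δ : ℝ} (hδ : 0 < δ) :
    ∃ K : ℕ, 0 < K ∧ ∀ u v : unitInterval, |(u : ℝ) - v| ≤ 2 / K →
      (f u).1 ≤ (f v).1 + δ ∧ (f u).2 ≤ (f v).2 + δ := by
  obtain ⟨ρ, hρ, h⟩ := Metric.uniformContinuous_iff.1
    (CompactSpace.uniformContinuous_of_continuous hf) δ hδ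
  obtain ⟨K, hK⟩ := exists_nat_gt (2 / ρ)
  have hK0 : (0 : ℝ) < K := lt_trans (by positivity) hK
  refine ⟨K, by exact_mod_cast hK0, fun u v huv => ?_⟩
  have hd : dist u v < ρ := by
    rw [Subtype.dist_eq, Real.dist_eq]
    refine huv.trans_lt ?_
    rw [div_lt_iff₀ hK0]
    rw [div_lt_iff₀ hρ] at hK
    linarith
  have := h hd
  rw [Prod.dist_eq, max_lt_iff, Real.dist_eq, Real.dist_eq, abs_lt, abs_lt] at this
  constructor <;> linarith [this.1.2, this.2.2]

lemma integrable_of_continuous {g : unitInterval → ℝ} (hg : Continuous g) :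
    Integrable g (volume : Measure unitInterval) :=
  hg.integrable_of_hasCompactSupport (HasCompactSupport.of_compactSpace g)

/-- Squeeze: lowering the edge by `ε` reduces the cost at each time by at most `cost lam 1 1 * ε`.
-/
lemma tendsto_truncRate {lam : ℤ × ℤ → ℝ} (hlam : ∀ y ∈ jumps, 0 < lam y) (hf : Continuous f) :
    Tendsto (truncRate lam f) (𝓝[>] 0) (𝓝 (truncRate lam f 0)) := by
  obtain ⟨-, -, h3, h4, h5⟩ := lam_pos hlam
  have hcomp : ∀ ε, 0 ≤ ε → ∀ t, truncCost lam f ε t ≤ truncCost lam f 0 t ∧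
      truncCost lam f 0 t ≤ truncCost lam f ε t + cost lam 1 1 * ε := by
    intro ε hε t
    constructor
    · refine cost_mono hlam ?_ ?_ <;> exact max_le_max (by linarith) le_rfl
    · rw [cost_one, truncCost, truncCost, ← cost_add]
      refine cost_mono hlam ?_ ?_
      · exact max_le (by linarith [le_max_left ((f t).1 - ε) 0]) (by positivity)
      · exact max_le (by linarith [le_max_left ((f t).2 - ε) 0]) (by positivity)
  have hint : ∀ ε, Integrable (truncCost lam f ε) := fun ε =>
    integrable_of_continuous (continuous_truncCost lam hf ε)
  have hup : ∀ ε, 0 ≤ ε → truncRate lam f ε ≤ truncRate lam f 0 := fun ε hε =>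
    integral_mono (hint ε) (hint 0) fun t => (hcomp ε hε t).1
  have hlo : ∀ ε, 0 ≤ ε → truncRate lam f 0 - cost lam 1 1 * ε ≤ truncRate lam f ε := by
    intro ε hε
    have := integral_mono (hint 0) ((hint ε).add (integrable_const (cost lam 1 1 * ε)))
      fun t => (hcomp ε hε t).2
    have e : ∫ t : unitInterval, (truncCost lam f ε t + cost lam 1 1 * ε) =
        truncRate lam f ε + cost lam 1 1 * ε := by
      rw [integral_add (hint ε) (integrable_const _)]
      simp [truncRate]
    have this' : truncRate lam f 0 ≤ truncRate lam f ε + cost lam 1 1 * ε := this.trans_eq e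
    linarith
  have hlim : Tendsto (fun ε : ℝ => truncRate lam f 0 - cost lam 1 1 * ε) (𝓝[>] 0)
      (𝓝 (truncRate lam f 0)) := by
    have : Continuous fun ε : ℝ => truncRate lam f 0 - cost lam 1 1 * ε := by fun_prop
    have := this.tendsto 0
    rw [mul_zero, sub_zero] at this
    exact this.mono_left nhdsWithin_le_nhds
  refine tendsto_of_tendsto_of_tendsto_of_le_of_le' hlim tendsto_const_nhds ?_ ?_
  · filter_upwards [self_mem_nhdsWithin] with ε hε using hlo ε (le_of_lt hε)
  · filter_upwards [self_mem_nhdsWithin] with ε hε using hup ε (le_of_lt hε)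

lemma rate_of_mem {lam : ℤ × ℤ → ℝ} {x : unitInterval → ℝ × ℝ} (hx : x ∈ excursions) :
    rate lam x = ((∫ t, cost lam (x t).1 (x t).2 : ℝ) : EReal) := by
  rw [rate, if_pos hx]
  rfl

lemma rate_eq_truncRate {lam : ℤ × ℤ → ℝ} (hf : f ∈ excursions) :
    rate lam f = ((truncRate lam f 0 : ℝ) : EReal) := by
  rw [rate_of_mem hf, truncRate]
  congr 2
  ext t
  have := hf.1.1 t
  rw [truncCost, sub_zero, sub_zero, max_eq_left this.1, max_eq_left this.2]

/-- The infimum of the rate function over a strip is attained at its lower boundary. -/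
lemma iInf_rate_strip {lam : ℤ × ℤ → ℝ} (hlam : ∀ y ∈ jumps, 0 < lam y) (hf : f ∈ excursions) {M : ℝ}
    (hfM : ∀ t, (f t).1 ≤ M ∧ (f t).2 ≤ M) :
    ⨅ g ∈ excursions ∩ strip f M, rate lam g = rate lam f := by
  refine le_antisymm (iInf₂_le f ⟨hf, hf.1, fun t => ⟨⟨le_rfl, (hfM t).1⟩, ⟨le_rfl, (hfM t).2⟩⟩⟩)
    (le_iInf₂ fun g hg => ?_)
  rw [rate_of_mem hf, rate_of_mem hg.1, EReal.coe_le_coe_iff]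
  have hc : ∀ x : unitInterval → ℝ × ℝ, Continuous x → Continuous fun t => cost lam (x t).1 (x t).2 := by
    intro x hx
    unfold cost
    fun_prop
  exact integral_mono (integrable_of_continuous (hc f hf.2.1))
    (integrable_of_continuous (hc g hg.1.2.1)) fun t => cost_mono hlam (hg.2.2 t).1.1 (hg.2.2 t).2.1

end Bounds

/-! ### The limit in `T` for fixed `ε`. -/

section Limit

variable {Ω : Type*} [MeasurableSpace Ω] {lam : ℤ × ℤ → ℝ} {P : Measure Ω}
  {Z : ℕ → Ω → ℕ × ℕ} {τ : ℕ → Ω → ℝ} [IsProbabilityMeasure P] {ξ : ℝ≥0 → Ω → ℕ × ℕ}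
  {f : unitInterval → ℝ × ℝ}

lemma HasJumpLaw.exists_le_logProb (h : HasJumpLaw lam P Z τ) (hlam : ∀ y ∈ jumps, 0 < lam y)
    (hξ : ∀ᵐ ω ∂P, ∀ (n : ℕ) (t : ℝ≥0), ∑ i ∈ Finset.range n, τ i ω ≤ (t : ℝ) →
      (t : ℝ) < ∑ i ∈ Finset.range (n + 1), τ i ω → ξ t ω = Z n ω)
    (hf : Continuous f) (hf0 : f 0 = (0, 0)) {ε M δ : ℝ} (hM : 0 < M)
    (hfM : ∀ t, (f t).1 ≤ M ∧ (f t).2 ≤ M) (hδ : 0 < δ) (hδε : δ < ε) (hδM : δ < M) :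
    ∃ C l K : ℝ, ∀ᶠ T in atTop, ((1 / T ^ 2 * (K * (2 * (T * M + 1) + 1) *
      (Real.log (l / 2) - 2 * Real.log T) - (C * T + T ^ 2 *
        (truncRate lam f ε + 2 * cost lam 1 1 * δ))) : ℝ) : EReal) ≤
        logProb P ξ (stripEps f ε M) T := by
  obtain ⟨hl1, hl2, hl3, hl4, hl5⟩ := lam_pos hlam
  obtain ⟨K, hK, hunif⟩ := exists_grid hf hδ
  have hK' : (0 : ℝ) < K := by exact_mod_cast hK
  obtain ⟨l, hl0, hl⟩ : ∃ l : ℝ, 0 < l ∧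
      (l ≤ lam (1, 0) ∧ l ≤ lam (0, 1) ∧ l ≤ lam (-1, 0) ∧ l ≤ lam (0, -1)) :=
    ⟨min (min (lam (1, 0)) (lam (0, 1))) (min (lam (-1, 0)) (lam (0, -1))), by positivity, by simp⟩
  refine ⟨lam (1, 0) + lam (0, 1) + cost lam 1 1, l, K, ?_⟩
  have hinv : Tendsto (fun T : ℝ => T⁻¹) atTop (𝓝 0) := tendsto_inv_atTop_zero
  have ev1 : ∀ᶠ T : ℝ in atTop, δ + 2 / T < min ε M := by
    have : Tendsto (fun T : ℝ => δ + 2 * T⁻¹) atTop (𝓝 δ) := by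
      simpa using (hinv.const_mul 2).const_add δ
    exact this.eventually_lt_const (lt_min hδε hδM)
  have ev2 : ∀ᶠ T : ℝ in atTop, l ≤ T ^ 2 :=
    (tendsto_pow_atTop two_ne_zero).eventually_ge_atTop l
  have ev3 : ∀ᶠ T : ℝ in atTop,
      lam (1, 0) + lam (0, 1) + cost lam 1 1 * (T * M + 1) ≤ T ^ 2 := by
    have h1 : ∀ᶠ T : ℝ in atTop, lam (1, 0) + lam (0, 1) + cost lam 1 1 * (M + 1) ≤ T :=
      eventually_ge_atTop _
    filter_upwards [h1, eventually_ge_atTop 1] with T hT hT1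
    have hc := cost_one_nonneg hlam
    have : (lam (1, 0) + lam (0, 1) + cost lam 1 1 * (M + 1)) * T ≤ T * T :=
      mul_le_mul_of_nonneg_right hT (by linarith)
    nlinarith
  have ev4 : ∀ᶠ T : ℝ in atTop, (K : ℝ) * (2 * (T * M + 1) + 1) / T ^ 2 ≤ T / K := by
    have h1 : ∀ᶠ T : ℝ in atTop, (K : ℝ) * (2 * M + 3) * K ≤ T := eventually_ge_atTop _
    filter_upwards [h1, eventually_ge_atTop 1] with T hT hT1
    rw [div_le_div_iff₀ (by positivity) hK']
    have h2 : 2 * (T * M + 1) + 1 ≤ (2 * M + 3) * T := by nlinarith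
    calc (K : ℝ) * (2 * (T * M + 1) + 1) * K ≤ K * ((2 * M + 3) * T) * K := by gcongr
      _ = K * (2 * M + 3) * K * T := by ring
      _ ≤ T * T := mul_le_mul_of_nonneg_right hT (by linarith)
      _ ≤ T * T ^ 2 := by gcongr; nlinarith
  filter_upwards [ev1, ev2, ev3, ev4, eventually_ge_atTop 1] with T h1 h2 h3 h4 hT
  have hT0 : 0 < T := by linarith
  have hb := h.le_measure_stripEps hlam hξ hf hf0 hfM hT hδ.le (h1.le.trans (min_le_left _ _))
    (h1.le.trans (min_le_right _ _)) hK hunif hl hl0.le h2 h3 h4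
  refine coe_le_mul_log (by positivity) (le_trans (ENNReal.ofReal_le_ofReal ?_) hb)
  rw [sub_eq_add_neg, Real.exp_add]
  refine mul_le_mul_of_nonneg_right ?_ (Real.exp_pos _).le
  have hq : 0 < l * (1 / T ^ 2) / 2 := by positivity
  have hlogq : Real.log (l / 2) - 2 * Real.log T = Real.log (l * (1 / T ^ 2) / 2) := by
    have : l * (1 / T ^ 2) / 2 = l / 2 / T ^ 2 := by ring
    rw [this, Real.log_div (x := l / 2) (by positivity) (by positivity), Real.log_pow]
    push_cast
    ring
  have hneg : Real.log (l * (1 / T ^ 2) / 2) ≤ 0 := by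
    refine Real.log_nonpos hq.le ?_
    have : l * (1 / T ^ 2) ≤ 1 := by rwa [mul_one_div, div_le_one (by positivity)]
    linarith
  -- The logarithm is nonpositive, so replacing the floor in the number of jumps by `T * M` only
  -- weakens the lower bound.
  rw [hlogq, ← Real.exp_log (pow_pos hq _), Real.log_pow]
  refine Real.exp_le_exp.2 (mul_le_mul_of_nonpos_right ?_ hneg)
  push_cast
  have := Nat.floor_le (show 0 ≤ T * M by positivity)
  gcongr

/-- For a fixed `ε`, the logarithm of the probability of the strip is asymptotic to the cost of the
lowest path in the strip. -/
lemma HasJumpLaw.tendsto_logProb (h : HasJumpLaw lam P Z τ) (hlam : ∀ y ∈ jumps, 0 < lam y)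
    (hξ : ∀ᵐ ω ∂P, ∀ (n : ℕ) (t : ℝ≥0), ∑ i ∈ Finset.range n, τ i ω ≤ (t : ℝ) →
      (t : ℝ) < ∑ i ∈ Finset.range (n + 1), τ i ω → ξ t ω = Z n ω)
    (hf : Continuous f) (hf0 : f 0 = (0, 0)) {ε M : ℝ} (hε : 0 < ε) (hM : 0 < M)
    (hfM : ∀ t, (f t).1 ≤ M ∧ (f t).2 ≤ M) :
    Tendsto (logProb P ξ (stripEps f ε M)) atTop (𝓝 ((-truncRate lam f ε : ℝ) : EReal)) := by
  refine tendsto_order.2 ⟨fun b hb => ?_, fun b hb => ?_⟩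
  · obtain ⟨r, hbr, hr⟩ := EReal.lt_iff_exists_real_btwn.1 hb
    rw [EReal.coe_lt_coe_iff] at hr
    have hc := cost_one_nonneg hlam
    -- The discretisation error must fit in the gap between `r` and the limit, so `δ`, and with it
    -- the grid, is fixed before `T` grows.
    obtain ⟨δ, hδ, hδε, hδM, hδr⟩ : ∃ δ : ℝ, 0 < δ ∧ δ < ε ∧ δ < M ∧
        r < -(truncRate lam f ε + 2 * cost lam 1 1 * δ) := by
      have hcont : Continuous fun δ : ℝ => -(truncRate lam f ε + 2 * cost lam 1 1 * δ) := by fun_prop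
      have h0 : ∀ᶠ δ : ℝ in 𝓝[>] 0, r < -(truncRate lam f ε + 2 * cost lam 1 1 * δ) := by
        refine ((hcont.tendsto 0).mono_left nhdsWithin_le_nhds).eventually_const_lt ?_
        simpa using hr
      obtain ⟨δ, h1, h2, h3, h4⟩ := (h0.and ((eventually_nhdsWithin_of_eventually_nhds
        (eventually_lt_nhds hε)).and ((eventually_nhdsWithin_of_eventually_nhds
        (eventually_lt_nhds hM)).and (eventually_mem_nhdsWithin)))).exists
      exact ⟨δ, h4, h2, h3, h1⟩
    obtain ⟨C, l, K, hev⟩ := h.exists_le_logProb hlam hξ hf hf0 hM hfM hδ hδε hδM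
    filter_upwards [hev, (tendsto_lower_exponent (truncRate lam f ε + 2 * cost lam 1 1 * δ) C M l
      K).eventually_const_lt hδr] with T h1 h2
    exact (hbr.trans (EReal.coe_lt_coe_iff.2 h2)).trans_le h1
  · obtain ⟨r, hr, hbr⟩ := EReal.lt_iff_exists_real_btwn.1 hb
    rw [EReal.coe_lt_coe_iff] at hr
    filter_upwards [(tendsto_upper_exponent (truncRate lam f ε)
      (2 * (lam (1, 0) + lam (0, 1) + cost lam M M)) (lam (1, 0) + lam (0, 1) + cost lam M M)
      ).eventually_lt_const hr, eventually_ge_atTop 1] with T h1 hT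
    refine lt_of_le_of_lt ?_ ((EReal.coe_lt_coe_iff.2 h1).trans hbr)
    refine mul_log_le_coe (by positivity) ((h.measure_stripEps_le hlam hξ hf hM.le hT).trans_eq ?_)
    rw [Real.exp_add (Real.log _), Real.exp_log (by positivity)]

end Limit

end StripLDP

theorem theorem2 {Ω : Type*} [MeasurableSpace Ω] (P : Measure Ω) [IsProbabilityMeasure P]
    (lam : ℤ × ℤ → ℝ) (hlam : ∀ y ∈ StripLDP.jumps, 0 < lam y)
    (ξ : ℝ≥0 → Ω → ℕ × ℕ) (hξ : StripLDP.IsJumpProcess lam P ξ)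
    (f : unitInterval → ℝ × ℝ) (hf : f ∈ StripLDP.excursions)
    (M : ℝ) (hM : ⨆ t : unitInterval, max (f t).1 (f t).2 < M) :
    (∃ L : ℝ → EReal,
      (∀ ε : ℝ, 0 < ε →
        Tendsto (StripLDP.logProb P ξ (StripLDP.stripEps f ε M)) atTop (𝓝 (L ε))) ∧
      Tendsto L (𝓝[>] (0 : ℝ))
        (𝓝 (-⨅ g ∈ StripLDP.excursions ∩ StripLDP.strip f M, StripLDP.rate lam g))) ∧
    (-⨅ g ∈ StripLDP.excursions ∩ StripLDP.strip f M, StripLDP.rate lam g) =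
      -StripLDP.rate lam f := by
  obtain ⟨Z, τ, hZ, hτ, hlaw, hpath⟩ := hξ
  have h : StripLDP.HasJumpLaw lam P Z τ := ⟨hZ, hτ, hlaw⟩
  have hfc : Continuous f := hf.2.1
  have hbdd : BddAbove (Set.range fun t => max (f t).1 (f t).2) :=
    (isCompact_range (by fun_prop)).bddAbove
  have hfM : ∀ t, (f t).1 ≤ M ∧ (f t).2 ≤ M := fun t =>
    max_le_iff.1 ((le_ciSup hbdd t).trans hM.le)
  have hM0 : 0 < M := (hf.2.2.2 1 zero_lt_one).1.trans_le (hfM 1).1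
  have hinf := StripLDP.iInf_rate_strip hlam hf hfM
  refine ⟨⟨fun ε => ((-StripLDP.truncRate lam f ε : ℝ) : EReal), fun ε hε =>
    h.tendsto_logProb hlam hpath hfc hf.2.2.1 hε hM0 hfM, ?_⟩, by rw [hinf]⟩
  rw [hinf, StripLDP.rate_eq_truncRate hf, ← EReal.coe_neg]
  exact (continuous_coe_real_ereal.tendsto _).comp (StripLDP.tendsto_truncRate hlam hfc).neg
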